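/- **Theorem 3.6.** Let $\mathsf X$ be a Polish space with its Borel $\sigma$-field, let $\mu$ be a measure on $\mathsf X$, and let $\pi$ be a probability density with respect to $\mu$ which is continuous, positive everywhere and bounded. For $V:\mathsf X\to(0,\infty)$ let $\mathcal L_V$ be the set of functions $f:\mathsf X\to\mathbb R$ with $\sup_x |f(x)|/V(x)<\infty$. Let $K\ge 1$, $1=T_1<T_2<\dots<T_K<T_\star$ and $\upsilon\in(0,1)$. For each $i\in\{1,\dots,K-1\}$ let $P^{(i)}$ be a Markov transition kernel on $\mathsf X$ that is $\pi$-irreducible (i.e. for every $x$ and every measurable $A$ with $\int_A\pi\,d\mu>0$ there is $n$ with $(P^{(i)})^n(x,A)>0$) and Feller (i.e. maps bounded continuous functions to bounded continuous functions), and such that (i) the measure with density $\pi^{1/T_i}$ with respect to $\mu$ is invariant under $P^{(i)}$; (ii) for every $s\in(0,1/T_i)$ there are $\lambda\in(0,1)$ and $b<\infty$ with $P^{(i)}\pi^{-s}\le\lambda\,\pi^{-s}+b$ on $\mathsf X$. Let $X^{(i)}=(X^{(i)}_n)_{n\ge0}$, $1\le i\le K$, be $\mathsf X$-valued processes on a probability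 space forming a $K$-stage interacting tempering algorithm with interaction probability $\upsilon$: for each $i\in\{1,\dots,K-1\}$ there is a filtration $(\mathcal F^{(i)}_n)_{n\ge0}$ to which $X^{(i)}$ and $X^{(i+1)}$ are adapted, such that for every $n\ge 0$ and every bounded measurable $g:\mathsf X\to\mathbb R$, almost surely $$\mathbb E\big[g(X^{(i)}_{n+1})\,\big|\,\mathcal F^{(i)}_n\big]=(1-\upsilon)\,P^{(i)}g(X^{(i)}_n)+\frac{\upsilon}{n+1}\sum_{l=0}^{n}\Big[\alpha_i(X^{(i)}_n,X^{(i+1)}_l)\,g(X^{(i+1)}_l)+\big(1-\alpha_i(X^{(i)}_n,X^{(i+1)}_l)\big)\,g(X^{(i)}_n)\Big],$$ where $\alpha_i(x,z)=1\wedge\big(\pi(x)/\pi(z)\big)^{1/T_{i+1}-1/T_i}$. (The process $X^{(K)}$ need not be a Markov chain.) Assume that there is $\tilde T\in(T_K,T_\star)$ such that (iii) $\int\pi^{1/T_K-1/\tilde T}\,d\mu<\infty$; (iv) for every continuous $f\in\mathcal L_{\pi^{-1/\tilde T}}$, almost surely $$\frac1n\sum_{k=1}^n f(X^{(K)}_k)\longrightarrow\int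 f\,\frac{\pi^{1/T_K}}{\int\pi^{1/T_K}\,d\mu}\,d\mu;$$ (v) $\sup_{n\ge0}\mathbb E\big[\pi^{-1/\tilde T}(X^{(K)}_n)\big]<\infty$; and that $\mathbb E\big[\pi^{-1/\tilde T}(X^{(i)}_0)\big]<\infty$ for every $i\in\{1,\dots,K-1\}$. Then for every continuous $f\in\mathcal L_{\pi^{-1/T_\star}}$ the function $f\pi$ is $\mu$-integrable and $$\frac1n\sum_{k=1}^n f(X^{(1)}_k)\longrightarrow\int f\,\pi\,d\mu\qquad\text{almost surely.}$$ -/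

import Mathlib

open MeasureTheory ProbabilityTheory Filter
open scoped ENNReal NNReal Topology

noncomputable section

namespace InteractingTempering

/-- `p` is a continuous, positive, bounded probability density with respect to `μ`. -/
structure IsTargetDensity {S : Type*} [TopologicalSpace S] [MeasurableSpace S]
    (μ : Measure S) (p : S → ℝ) : Prop where
  continuous : Continuous p
  pos : ∀ x, 0 < p x
  bddAbove : BddAbove (Set.range p)
  lintegral_eq_one : ∫⁻ x, ENNReal.ofReal (p x) ∂μ = 1

/-- The (unnormalised) measure with density `p ^ a` with respect to `μ`. -/
def powMeasure {S : Type*} [MeasurableSpace S] (μ : Measure S) (p : S → ℝ) (a : ℝ) :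
    Measure S :=
  μ.withDensity (fun x => ENNReal.ofReal (p x ^ a))

/-- (Weak) Feller property: the kernel maps bounded continuous functions to bounded continuous
functions. Boundedness of the image is automatic for a Markov kernel. -/
def IsFeller {S : Type*} [TopologicalSpace S] [MeasurableSpace S] (P : Kernel S S) : Prop :=
  ∀ f : BoundedContinuousFunction S ℝ, Continuous (fun x => ∫ y, f y ∂(P x))

/-- The Foster-Lyapunov drift inequality `P U ≤ l U + b` for some `l ∈ (0, 1)` and `b < ∞`. -/
def HasDrift {S : Type*} [MeasurableSpace S] (P : Kernel S S) (U : S → ℝ) : Prop :=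
  ∃ l ∈ Set.Ioo (0 : ℝ) 1, ∃ b : ℝ≥0, ∀ x,
    ∫⁻ y, ENNReal.ofReal (U y) ∂(P x) ≤ ENNReal.ofReal (l * U x) + b

/-- `f` belongs to `𝓛_V`: the weighted norm `sup_x |f x| / V x` is finite. -/
def MemWeighted {S : Type*} (V : S → ℝ) (f : S → ℝ) : Prop :=
  BddAbove (Set.range (fun x => |f x| / V x))

/-- The acceptance probability `1 ∧ (p x / p z) ^ (1 / T' - 1 / T)` of a swap from the current
state `x`, at temperature `T`, to a state `z` drawn from the past at temperature `T'`. -/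
def acceptProb {S : Type*} (p : S → ℝ) (T T' : ℝ) (x z : S) : ℝ :=
  min 1 ((p x / p z) ^ (1 / T' - 1 / T))

/-- Law of the state reached from `x` by the interaction move: draw `z` from `θ`, move to `z`
with probability `acceptProb p T T' x z`, and stay at `x` otherwise. -/
def interactionLaw {S : Type*} [MeasurableSpace S] (p : S → ℝ) (T T' : ℝ)
    (θ : Measure S) (x : S) : Measure S :=
  θ.withDensity (fun z => ENNReal.ofReal (acceptProb p T T' x z))
    + (∫⁻ z, ENNReal.ofReal (1 - acceptProb p T T' x z) ∂θ) • Measure.dirac x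

/-- One-step law `P_θ(x, ·) = (1 - υ) P(x, ·) + υ K_θ(x, ·)` of interacting tempering. -/
def stepLaw {S : Type*} [MeasurableSpace S] (υ : ℝ) (P : Kernel S S) (p : S → ℝ) (T T' : ℝ)
    (θ : Measure S) (x : S) : Measure S :=
  ENNReal.ofReal (1 - υ) • P x + ENNReal.ofReal υ • interactionLaw p T T' θ x

/-- The empirical measure `(n + 1)⁻¹ ∑_{l=0}^n δ_{Y_l}` of the past of `Y` up to time `n`. -/
def empiricalMeasure {S Ω : Type*} [MeasurableSpace S] (Y : ℕ → Ω → S) (n : ℕ) (ω : Ω) :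
    Measure S :=
  ((n : ℝ≥0∞) + 1)⁻¹ • ∑ l ∈ Finset.range (n + 1), Measure.dirac (Y l ω)

/-- `X i n` is the state at time `n` of the chain at temperature `T i`, for levels `i = 1, …, K`.
At each level `i < K`, given the past up to time `n` of the chains at the levels `i` and `i + 1`,
the state `X i (n + 1)` is drawn from the interacting tempering step, where the interaction
uses the empirical measure of the past of the chain at level `i + 1`. The conditioning is on some
filtration to which both chains are adapted. Nothing but measurability is required of the
chain at level `K`. -/
structure IsInteractingTempering {S Ω : Type*} [MeasurableSpace S] {mΩ : MeasurableSpace Ω}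
    (ν : Measure Ω) (K : ℕ) (υ : ℝ) (p : S → ℝ) (T : ℕ → ℝ) (P : ℕ → Kernel S S)
    (X : ℕ → ℕ → Ω → S) : Prop where
  measurable : ∀ i, 1 ≤ i → i ≤ K → ∀ n, Measurable (X i n)
  step : ∀ i, 1 ≤ i → i < K → ∃ ℱ : Filtration ℕ mΩ,
    Adapted ℱ (X i) ∧ Adapted ℱ (X (i + 1)) ∧
    ∀ (n : ℕ) (f : S → ℝ), Measurable f → (∃ C : ℝ, ∀ x, |f x| ≤ C) →
      ν[fun ω => f (X i (n + 1) ω) | ℱ n] =ᵐ[ν]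
        fun ω => ∫ y, f y ∂(stepLaw υ (P i) p (T i) (T (i + 1))
          (empiricalMeasure (X (i + 1)) n ω) (X i n ω))

end InteractingTempering

end

open MeasureTheory ProbabilityTheory Filter
open scoped ENNReal NNReal Topology

noncomputable section

namespace InteractingTempering

/-! The law of large numbers is passed down the temperatures, from level `i + 1` to level `i`. Put
`a = 1 / T i`, `a' = 1 / T (i + 1)`, `q = p ^ (a - a')`, and let `ρ`, `θ` be the probabilities
proportional to `p ^ a`, `p ^ a'`. A swap from `x` to `z` is accepted with probability `q z / max (q
z) (q x)`. Three features of this formula carry the proof.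

It is at least `q z / Q` when `q ≤ Q`, whatever `x` is. So the limiting operator `A = P_θ` satisfies
a Doeblin condition supplied by the swaps alone (`temperOp_contracts`). Since `θ` has density
proportional to `1 / q` with respect to `ρ`, the swap kernel relative to `ρ` is the symmetric `1 /
max (q z) (q x)`, and `A` preserves `ρ` (`integral_temperOp`). Hence `A^N f` tends to `∫ f dρ`
uniformly and geometrically (`temperOp_iterate`).

It depends on `x` only through `t = q x`, which lies in the compact `[0, Q]`, and it is antitone in
`t`. Pólya's theorem therefore turns the law of large numbers at level `i + 1` into convergence of
`P_{θ_n} f` to `A f` uniformly in `x`, where `θ_n` is the empirical measure. With a martingale law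
of large numbers, the averages of `f - A f` along the chain vanish; iterating, so do those of `f -
A^N f`, and letting `N → ∞` settles bounded continuous `f` (`ae_tendsto_runningAvg_of_bounded`).

For `f` dominated by `p ^ (-s)` with `s < t = 1 / Ttilde`, truncation leaves an error controlled by
averages of `p ^ (-s')`, `s < s' < t`. These stay bounded almost surely: the drift inequality
survives the swaps up to a term averaging `p ^ (-s')` over level `i + 1`, and the `t`-moments,
bounded at every level, give `p ^ (-s')` moments of order `t / s' > 1`, enough for a truncated
martingale argument along powers of two (`ae_exists_runningAvg_le_of_drift`).

The induction carries `HasSLLN` for all `s < t` with one fixed `t`, together with the moment bound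
at `t` itself, so no exponent is lost from level to level. -/

/-! ### Running averages -/

/-- The running average `n⁻¹ ∑_{k < n} a k`. -/
def runningAvg (a : ℕ → ℝ) (n : ℕ) : ℝ := (n : ℝ)⁻¹ * ∑ k ∈ Finset.range n, a k

lemma runningAvg_add (a b : ℕ → ℝ) (n : ℕ) :
    runningAvg (fun k => a k + b k) n = runningAvg a n + runningAvg b n := by
  simp only [runningAvg, Finset.sum_add_distrib, mul_add]

lemma runningAvg_sub (a b : ℕ → ℝ) (n : ℕ) :
    runningAvg (fun k => a k - b k) n = runningAvg a n - runningAvg b n := by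
  simp only [runningAvg, Finset.sum_sub_distrib, mul_sub]

lemma runningAvg_const_mul (c : ℝ) (a : ℕ → ℝ) (n : ℕ) :
    runningAvg (fun k => c * a k) n = c * runningAvg a n := by
  simp only [runningAvg, ← Finset.mul_sum]; ring

lemma runningAvg_mono {a b : ℕ → ℝ} (h : ∀ k, a k ≤ b k) (n : ℕ) :
    runningAvg a n ≤ runningAvg b n := by
  unfold runningAvg
  gcongr with k _
  exact h k

lemma runningAvg_const_of_pos (c : ℝ) {n : ℕ} (hn : 0 < n) : runningAvg (fun _ => c) n = c := by
  have : (n : ℝ) ≠ 0 := by positivity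
  simp [runningAvg, this]

lemma tendsto_runningAvg_const (c : ℝ) : Tendsto (runningAvg fun _ => c) atTop (𝓝 c) := by
  refine tendsto_const_nhds.congr' ?_
  filter_upwards [eventually_gt_atTop 0] with n hn
  rw [runningAvg_const_of_pos c hn]

lemma sum_range_succ_eq_Icc (a : ℕ → ℝ) (n : ℕ) :
    ∑ k ∈ Finset.range (n + 1), a k = a 0 + ∑ k ∈ Finset.Icc 1 n, a k := by
  rw [Finset.range_eq_Ico, Finset.sum_eq_sum_Ico_succ_bot (Nat.succ_pos n)]
  rfl

lemma tendsto_Icc_avg_iff {a : ℕ → ℝ} {L : ℝ} :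
    Tendsto (fun n : ℕ => (n : ℝ)⁻¹ * ∑ k ∈ Finset.Icc 1 n, a k) atTop (𝓝 L) ↔
      Tendsto (runningAvg a) atTop (𝓝 L) := by
  have h0 : Tendsto (fun n : ℕ => 1 / ((n : ℝ) + 1)) atTop (𝓝 0) :=
    tendsto_one_div_add_atTop_nhds_zero_nat
  have h1 : Tendsto (fun n : ℕ => 1 / (n : ℝ)) atTop (𝓝 0) := tendsto_one_div_atTop_nhds_zero_nat
  rw [← tendsto_add_atTop_iff_nat (f := runningAvg a) 1]
  constructor
  · intro h
    have : Tendsto (fun n : ℕ => (1 - 1 / ((n : ℝ) + 1)) *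
        ((n : ℝ)⁻¹ * ∑ k ∈ Finset.Icc 1 n, a k) + a 0 * (1 / ((n : ℝ) + 1))) atTop
        (𝓝 ((1 - 0) * L + a 0 * 0)) :=
      ((tendsto_const_nhds.sub h0).mul h).add (tendsto_const_nhds.mul h0)
    rw [show (1 - 0) * L + a 0 * 0 = L by ring] at this
    refine this.congr' ?_
    filter_upwards [eventually_gt_atTop 0] with n hn
    have hn' : (n : ℝ) ≠ 0 := by positivity
    have hn1 : (n : ℝ) + 1 ≠ 0 := by positivity
    rw [runningAvg, sum_range_succ_eq_Icc]
    push_cast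
    field_simp
    ring
  · intro h
    have : Tendsto (fun n : ℕ => (1 + 1 / (n : ℝ)) * runningAvg a (n + 1) - a 0 * (1 / (n : ℝ)))
        atTop (𝓝 ((1 + 0) * L - a 0 * 0)) :=
      ((tendsto_const_nhds.add h1).mul h).sub (tendsto_const_nhds.mul h1)
    rw [show (1 + 0) * L - a 0 * 0 = L by ring] at this
    refine this.congr' ?_
    filter_upwards [eventually_gt_atTop 0] with n hn
    have hn' : (n : ℝ) ≠ 0 := by positivity
    have hn1 : (n : ℝ) + 1 ≠ 0 := by positivity
    rw [runningAvg, sum_range_succ_eq_Icc]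
    push_cast
    field_simp
    ring

/-- Averages of `a` converge if `a` is approximated by sequences with convergent averages, up to
errors controlled by a sequence with bounded averages. -/
lemma tendsto_runningAvg_of_approx {a w : ℕ → ℝ} {b : ℕ → ℕ → ℝ} {L : ℝ} {l e : ℕ → ℝ} {B : ℝ}
    (hb : ∀ m, Tendsto (runningAvg (b m)) atTop (𝓝 (l m)))
    (he : Tendsto e atTop (𝓝 0)) (he0 : ∀ m, 0 ≤ e m) (hl : Tendsto l atTop (𝓝 L))
    (hw : ∀ n, runningAvg w n ≤ B)
    (hab : ∀ m k, |a k - b m k| ≤ e m * w k) : Tendsto (runningAvg a) atTop (𝓝 L) := by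
  rw [Metric.tendsto_atTop]
  intro ε hε
  have h1 : ∀ᶠ m in atTop, e m * B < ε / 3 := by
    have : Tendsto (fun m => e m * B) atTop (𝓝 (0 * B)) := he.mul_const B
    rw [zero_mul] at this
    exact this.eventually (gt_mem_nhds (by positivity))
  have h2 : ∀ᶠ m in atTop, |l m - L| < ε / 3 := by
    have := (Metric.tendsto_atTop.1 hl (ε / 3) (by positivity))
    simpa [Real.dist_eq] using this
  obtain ⟨m, hm1, hm2⟩ := (h1.and h2).exists
  obtain ⟨N, hN⟩ := Metric.tendsto_atTop.1 (hb m) (ε / 3) (by positivity)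
  refine ⟨N, fun n hn => ?_⟩
  have h3 := hN n hn
  rw [Real.dist_eq] at h3 ⊢
  have hup : runningAvg (fun k => a k - b m k) n ≤ e m * B :=
    (runningAvg_mono (fun k => (abs_le.1 (hab m k)).2) n).trans
      (by rw [runningAvg_const_mul]; exact mul_le_mul_of_nonneg_left (hw n) (he0 m))
  have hlo : -(e m * B) ≤ runningAvg (fun k => a k - b m k) n := by
    refine le_trans ?_ (runningAvg_mono (a := fun k => (- e m) * w k) (fun k => ?_) n)
    · rw [runningAvg_const_mul]
      nlinarith [mul_le_mul_of_nonneg_left (hw n) (he0 m)]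
    · have := (abs_le.1 (hab m k)).1
      linarith
  rw [runningAvg_sub] at hup hlo
  rw [abs_lt] at *
  constructor <;> linarith

/-! ### Monotone functions converging to a continuous limit -/

/-- Pólya's theorem: antitone functions converging on all uniform grids of `[0, Q]` to a continuous
function converge uniformly on `[0, Q]`. -/
lemma eventually_forall_abs_sub_le_of_antitone {Φ : ℕ → ℝ → ℝ} {φ : ℝ → ℝ} {Q : ℝ} (hQ : 0 < Q)
    (hΦ : ∀ n, Antitone (Φ n)) (hφc : Continuous φ)
    (h : ∀ m k : ℕ, Tendsto (fun n => Φ n (Q * ((k : ℝ) / m))) atTop (𝓝 (φ (Q * ((k : ℝ) / m)))))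
    {ε : ℝ} (hε : 0 < ε) : ∀ᶠ n in atTop, ∀ t ∈ Set.Icc 0 Q, |Φ n t - φ t| ≤ ε := by
  have huc := (isCompact_Icc (a := (0 : ℝ)) (b := Q)).uniformContinuousOn_of_continuous
    hφc.continuousOn
  obtain ⟨d, hd, hφd⟩ := Metric.uniformContinuousOn_iff.1 huc (ε / 2) (by positivity)
  obtain ⟨m, hm⟩ := exists_nat_gt (Q / d)
  have hm0 : (0 : ℝ) < m := lt_of_le_of_lt (by positivity) hm
  have hmN : 0 < m := by exact_mod_cast hm0
  have hmd : Q / m < d := by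
    rw [div_lt_iff₀ hd] at hm
    rw [div_lt_iff₀ hm0]; linarith
  have hgrid : ∀ᶠ n in atTop, ∀ k ∈ Finset.range (m + 1),
      |Φ n (Q * ((k : ℝ) / m)) - φ (Q * ((k : ℝ) / m))| < ε / 2 := by
    rw [Finset.eventually_all]
    intro k _
    simpa [Real.dist_eq] using Metric.tendsto_atTop.1 (h m k) (ε / 2) (by positivity)
  filter_upwards [hgrid] with n hn t ht
  obtain ⟨k, hk, hk1, hk2⟩ : ∃ k : ℕ, k + 1 ≤ m ∧ Q * ((k : ℝ) / m) ≤ t ∧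
      t ≤ Q * (((k + 1 : ℕ) : ℝ) / m) := by
    -- At `t = Q` the floor would be `m`, with no grid cell to its right, so the last cell is taken
    -- instead.
    rcases lt_or_eq_of_le ht.2 with htQ | htQ
    · refine ⟨⌊t * m / Q⌋₊, ?_, ?_, ?_⟩
      · have : ⌊t * m / Q⌋₊ < m := by
          rw [Nat.floor_lt (by have := ht.1; positivity), div_lt_iff₀ hQ]
          nlinarith
        omega
      · have := Nat.floor_le (show 0 ≤ t * m / Q by have := ht.1; positivity)
        rw [le_div_iff₀ hQ] at this
        rw [← mul_div_assoc, div_le_iff₀ hm0]; linarith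
      · have := (Nat.lt_floor_add_one (t * m / Q)).le
        rw [div_le_iff₀ hQ] at this
        rw [← mul_div_assoc, le_div_iff₀ hm0]; push_cast; linarith
    · refine ⟨m - 1, by omega, ?_, ?_⟩
      · rw [htQ]
        have : ((m - 1 : ℕ) : ℝ) / m ≤ 1 := by
          rw [div_le_one hm0]; exact_mod_cast Nat.sub_le m 1
        nlinarith
      · rw [Nat.sub_add_cancel hmN, div_self hm0.ne', mul_one, htQ]
  have hk' : ((k + 1 : ℕ) : ℝ) ≤ m := by exact_mod_cast hk
  have hlo : Q * ((k : ℝ) / m) ∈ Set.Icc 0 Q := ⟨by positivity, hk1.trans ht.2⟩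
  have hhi : Q * (((k + 1 : ℕ) : ℝ) / m) ∈ Set.Icc 0 Q := by
    refine ⟨by positivity, ?_⟩
    have : ((k + 1 : ℕ) : ℝ) / m ≤ 1 := by rw [div_le_one hm0]; exact hk'
    nlinarith
  have hgap : Q * (((k + 1 : ℕ) : ℝ) / m) - Q * ((k : ℝ) / m) = Q / m := by
    push_cast; field_simp; ring
  have h1 := hn k (by simp; omega)
  have h2 := hn (k + 1) (by simp; omega)
  have h3 := hφd _ hlo t ht (by rw [Real.dist_eq, abs_lt]; constructor <;> linarith)
  have h4 := hφd _ hhi t ht (by rw [Real.dist_eq, abs_lt]; constructor <;> linarith)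
  have m1 := hΦ n hk1
  have m2 := hΦ n hk2
  rw [Real.dist_eq] at h3 h4
  rw [abs_lt] at h1 h2 h3 h4
  rw [abs_le]
  constructor <;> linarith

/-! ### Almost sure bounds for compensated sums -/

section Martingale

variable {Ω : Type*} {mΩ : MeasurableSpace Ω} {ν : Measure Ω}

/-- By Tonelli the sum of the `f j` has finite integral, so the series converges almost surely and
its terms vanish. This plays the role of Borel–Cantelli below. -/
lemma ae_tendsto_zero_of_summable_integral {f : ℕ → Ω → ℝ} {c : ℕ → ℝ}
    (hf : ∀ j, Integrable (f j) ν) (h0 : ∀ j ω, 0 ≤ f j ω) (hc : Summable c)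
    (hle : ∀ j, ∫ ω, f j ω ∂ν ≤ c j) : ∀ᵐ ω ∂ν, Tendsto (fun j => f j ω) atTop (𝓝 0) := by
  have hc0 : ∀ j, 0 ≤ c j := fun j => (integral_nonneg (h0 j)).trans (hle j)
  have hsum : ∫⁻ ω, ∑' j, ENNReal.ofReal (f j ω) ∂ν ≠ ∞ := by
    rw [lintegral_tsum fun j => (hf j).aemeasurable.ennreal_ofReal]
    refine ne_top_of_le_ne_top hc.tsum_ofReal_ne_top (ENNReal.tsum_le_tsum fun j => ?_)
    rw [← ofReal_integral_eq_lintegral_ofReal (hf j) (Eventually.of_forall (h0 j))]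
    exact ENNReal.ofReal_le_ofReal (hle j)
  have hmeas : AEMeasurable (fun ω => ∑' j, ENNReal.ofReal (f j ω)) ν :=
    AEMeasurable.tsum fun j => (hf j).aemeasurable.ennreal_ofReal
  filter_upwards [ae_lt_top' hmeas hsum] with ω hω
  have := ENNReal.tendsto_atTop_zero_of_tsum_ne_top hω.ne
  have h := (ENNReal.tendsto_toReal ENNReal.zero_ne_top).comp this
  simpa [Function.comp_def, ENNReal.toReal_ofReal (h0 _ ω)] using h

/-- Orthogonality of a martingale increment to the past: `Z` can be pulled out of the conditional
expectation. -/
lemma integral_mul_sub_condExp_eq_zero [IsFiniteMeasure ν] {m : MeasurableSpace Ω} (hm : m ≤ mΩ)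
    {Z g : Ω → ℝ} (hZ : StronglyMeasurable[m] Z) {c : ℝ} (hZc : ∀ᵐ ω ∂ν, ‖Z ω‖ ≤ c)
    (hg : Integrable g ν) : ∫ ω, Z ω * (g ω - (ν[g | m]) ω) ∂ν = 0 := by
  have h1 := condExp_stronglyMeasurable_mul_of_bound hm hZ (hg.sub integrable_condExp) c hZc
    (g := g - ν[g | m])
  have h2 : ν[g - ν[g | m] | m] =ᵐ[ν] 0 := by
    refine (condExp_sub hg integrable_condExp m).trans ?_
    rw [condExp_of_stronglyMeasurable hm stronglyMeasurable_condExp integrable_condExp]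
    simp
  have h3 : ν[Z * (g - ν[g | m]) | m] =ᵐ[ν] 0 := by
    filter_upwards [h1, h2] with ω h1 h2
    rw [h1, Pi.mul_apply, h2]; simp
  have h4 := integral_condExp (μ := ν) (f := Z * (g - ν[g | m])) hm
  rw [integral_congr_ae h3] at h4
  simpa using h4.symm

/-- The compensated sum `∑_{k < n} (Y_{k+1} - E[Y_{k+1} | ℱ_k])`. -/
def compensatedSum (ν : Measure Ω) (ℱ : Filtration ℕ mΩ) (Y : ℕ → Ω → ℝ) (n : ℕ) (ω : Ω) : ℝ :=
  ∑ k ∈ Finset.range n, (Y (k + 1) ω - (ν[Y (k + 1) | ℱ k]) ω)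

variable {ℱ : Filtration ℕ mΩ} {Y : ℕ → Ω → ℝ} {C : ℝ}

lemma stronglyMeasurable_compensatedSum (hY : ∀ n, StronglyMeasurable[ℱ n] (Y n)) (n : ℕ) :
    StronglyMeasurable[ℱ n] (compensatedSum ν ℱ Y n) := by
  have : compensatedSum ν ℱ Y n =
      ∑ k ∈ Finset.range n, (fun ω => Y (k + 1) ω - (ν[Y (k + 1) | ℱ k]) ω) := by
    ext ω; simp [compensatedSum]
  rw [this]
  refine Finset.stronglyMeasurable_sum _ fun k hk => ?_
  have hk := Finset.mem_range.1 hk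
  exact ((hY (k + 1)).mono (ℱ.mono hk)).sub
    ((stronglyMeasurable_condExp).mono (ℱ.mono hk.le))

lemma ae_abs_sub_condExp_le (hC : ∀ n ω, |Y n ω| ≤ C) :
    ∀ᵐ ω ∂ν, ∀ k, |Y (k + 1) ω - (ν[Y (k + 1) | ℱ k]) ω| ≤ 2 * C := by
  rw [ae_all_iff]
  intro k
  have := ae_bdd_abs_condExp_of_ae_bdd_abs (m := ℱ k) (μ := ν) (R := C) (f := Y (k + 1))
    (Eventually.of_forall fun ω => hC (k + 1) ω)
  filter_upwards [this] with ω hω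
  have h1 := hC (k + 1) ω
  have h2 : |(ν[Y (k + 1) | ℱ k]) ω| ≤ C := hω
  rw [abs_le] at *
  constructor <;> linarith

lemma ae_abs_compensatedSum_sub_le (hC : ∀ n ω, |Y n ω| ≤ C) :
    ∀ᵐ ω ∂ν, ∀ m n, m ≤ n →
      |compensatedSum ν ℱ Y n ω - compensatedSum ν ℱ Y m ω| ≤ (n - m) * (2 * C) := by
  filter_upwards [ae_abs_sub_condExp_le (ν := ν) (ℱ := ℱ) hC] with ω hω m n hmn
  rw [compensatedSum, compensatedSum, ← Finset.sum_Ico_eq_sub _ hmn]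
  refine (Finset.abs_sum_le_sum_abs _ _).trans ?_
  refine (Finset.sum_le_card_nsmul _ _ (2 * C) fun k _ => hω k).trans ?_
  rw [Nat.card_Ico, nsmul_eq_mul, Nat.cast_sub hmn]

/-- Martingale increments are orthogonal, and centring only lowers a second moment. The bound keeps
the second moments of `Y` instead of `C ^ 2`, because it is later applied to truncations whose `C`
grows with `n`. -/
lemma integral_compensatedSum_sq_le [IsFiniteMeasure ν]
    (hY : ∀ n, StronglyMeasurable[ℱ n] (Y n)) (hC : ∀ n ω, |Y n ω| ≤ C) (n : ℕ) :
    Integrable (fun ω => compensatedSum ν ℱ Y n ω ^ 2) ν ∧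
    ∫ ω, compensatedSum ν ℱ Y n ω ^ 2 ∂ν ≤ ∑ k ∈ Finset.range n, ∫ ω, Y (k + 1) ω ^ 2 ∂ν := by
  have hSm : ∀ n, AEStronglyMeasurable (compensatedSum ν ℱ Y n) ν := fun n =>
    ((stronglyMeasurable_compensatedSum hY n).mono (ℱ.le n)).aestronglyMeasurable
  have hYm : ∀ n, AEStronglyMeasurable (Y n) ν := fun n =>
    ((hY n).mono (ℱ.le n)).aestronglyMeasurable
  have hYi : ∀ n, Integrable (Y n) ν := fun n =>
    Integrable.of_bound (hYm n) C (Eventually.of_forall fun ω => hC n ω)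
  have hSb : ∀ n, ∀ᵐ ω ∂ν, ‖compensatedSum ν ℱ Y n ω‖ ≤ n * (2 * C) := fun n => by
    filter_upwards [ae_abs_compensatedSum_sub_le (ν := ν) (ℱ := ℱ) hC] with ω hω
    simpa [compensatedSum] using hω 0 n (Nat.zero_le n)
  have hS2 : ∀ n, Integrable (fun ω => compensatedSum ν ℱ Y n ω ^ 2) ν := fun n => by
    refine Integrable.of_bound ((hSm n).pow 2) ((n * (2 * C)) ^ 2) ?_
    filter_upwards [hSb n] with ω hω
    rw [norm_pow]; gcongr
  refine ⟨hS2 n, ?_⟩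
  induction n with
  | zero => simp [compensatedSum]
  | succ n ih =>
    set D : Ω → ℝ := fun ω => Y (n + 1) ω - (ν[Y (n + 1) | ℱ n]) ω with hD
    set E : Ω → ℝ := ν[Y (n + 1) | ℱ n] with hE
    have hDm : AEStronglyMeasurable D ν := (hYm (n + 1)).sub integrable_condExp.1
    have hDb : ∀ᵐ ω ∂ν, ‖D ω‖ ≤ 2 * C := by
      filter_upwards [ae_abs_sub_condExp_le (ν := ν) (ℱ := ℱ) hC] with ω hω using hω n
    have hEb : ∀ᵐ ω ∂ν, ‖E ω‖ ≤ 3 * C := by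
      filter_upwards [hDb] with ω hω
      have := hC (n + 1) ω
      simp only [hD, Real.norm_eq_abs] at hω ⊢
      rw [abs_le] at *
      constructor <;> linarith
    have hDi : Integrable D ν := Integrable.of_bound hDm _ hDb
    have hEm : AEStronglyMeasurable E ν := integrable_condExp.1
    have hSD : Integrable (fun ω => compensatedSum ν ℱ Y n ω * D ω) ν :=
      hDi.bdd_mul (hSm n) (hSb n)
    have hED : Integrable (fun ω => E ω * D ω) ν := hDi.bdd_mul hEm hEb
    have hD2 : Integrable (fun ω => D ω ^ 2) ν := by
      simp_rw [sq]; exact hDi.bdd_mul hDm hDb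
    have h0 : ∫ ω, compensatedSum ν ℱ Y n ω * D ω ∂ν = 0 :=
      integral_mul_sub_condExp_eq_zero (ℱ.le n) (stronglyMeasurable_compensatedSum hY n) (hSb n)
        (hYi (n + 1))
    have h1 : ∫ ω, E ω * D ω ∂ν = 0 :=
      integral_mul_sub_condExp_eq_zero (ℱ.le n) stronglyMeasurable_condExp hEb (hYi (n + 1))
    have h2 : ∫ ω, D ω ^ 2 ∂ν ≤ ∫ ω, Y (n + 1) ω ^ 2 ∂ν := by
      have hY2 : Integrable (fun ω => Y (n + 1) ω ^ 2) ν := by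
        simp_rw [sq]
        exact (hYi _).bdd_mul (hYm _) (Eventually.of_forall fun ω => hC (n + 1) ω)
      -- Pythagoras: `Y ^ 2 = D ^ 2 + 2 E D + E ^ 2`, and the cross term integrates to zero.
      have : ∫ ω, (D ω ^ 2 + 2 * (E ω * D ω)) ∂ν ≤ ∫ ω, Y (n + 1) ω ^ 2 ∂ν := by
        refine integral_mono (hD2.add (hED.const_mul 2)) hY2 fun ω => ?_
        simp only [hD]
        nlinarith [sq_nonneg (E ω)]
      rwa [integral_add hD2 (hED.const_mul 2), integral_const_mul, h1, mul_zero, add_zero] at this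
    have h3 : ∫ ω, compensatedSum ν ℱ Y (n + 1) ω ^ 2 ∂ν =
        ∫ ω, compensatedSum ν ℱ Y n ω ^ 2 ∂ν + ∫ ω, D ω ^ 2 ∂ν := by
      have : ∀ ω, compensatedSum ν ℱ Y (n + 1) ω ^ 2 = compensatedSum ν ℱ Y n ω ^ 2 +
          2 * (compensatedSum ν ℱ Y n ω * D ω) + D ω ^ 2 := fun ω => by
        rw [compensatedSum, Finset.sum_range_succ, ← compensatedSum]
        simp only [hD, hE]; ring
      simp_rw [this]
      have hadd := (hS2 n).add (hSD.const_mul 2)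
      simp only [Pi.add_def] at hadd
      rw [integral_add hadd hD2,
        integral_add (hS2 n) (hSD.const_mul 2), integral_const_mul, h0]
      ring
    rw [h3, Finset.sum_range_succ]
    linarith

/-- Strong law of large numbers for bounded compensated sums. -/
lemma ae_tendsto_compensatedSum_div [IsProbabilityMeasure ν]
    (hY : ∀ n, StronglyMeasurable[ℱ n] (Y n)) (hC : ∀ n ω, |Y n ω| ≤ C) :
    ∀ᵐ ω ∂ν, Tendsto (fun n : ℕ => (n : ℝ)⁻¹ * compensatedSum ν ℱ Y n ω) atTop (𝓝 0) := by
  have hle : ∀ n, ∫ ω, compensatedSum ν ℱ Y n ω ^ 2 ∂ν ≤ n * C ^ 2 := fun n => by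
    refine (integral_compensatedSum_sq_le hY hC n).2.trans ?_
    refine (Finset.sum_le_card_nsmul _ _ (C ^ 2) fun k _ => ?_).trans (by simp)
    have := integral_mono_of_nonneg (μ := ν) (f := fun ω => Y (k + 1) ω ^ 2) (g := fun _ => C ^ 2)
      (Eventually.of_forall fun ω => sq_nonneg _) (integrable_const _)
      (Eventually.of_forall fun ω => sq_le_sq' (abs_le.1 (hC _ ω)).1 (abs_le.1 (hC _ ω)).2)
    simpa using this
  -- Along the squares `n = j ^ 2` the variances of the normalised sums are at most `C ^ 2 / j ^ 2`,
  -- which is summable.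
  have hsub := ae_tendsto_zero_of_summable_integral (ν := ν)
    (f := fun j ω => (((j ^ 2 : ℕ) : ℝ)⁻¹ * compensatedSum ν ℱ Y (j ^ 2) ω) ^ 2)
    (c := fun j => C ^ 2 * (1 / (j : ℝ) ^ 2))
    (fun j => by
      simp_rw [mul_pow]
      exact (integral_compensatedSum_sq_le hY hC (j ^ 2)).1.const_mul _)
    (fun j ω => sq_nonneg _)
    ((Real.summable_one_div_nat_pow.2 one_lt_two).mul_left _)
    (fun j => by
      simp_rw [mul_pow]
      rw [integral_const_mul]
      refine (mul_le_mul_of_nonneg_left (hle (j ^ 2)) (by positivity)).trans (le_of_eq ?_)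
      rcases eq_or_ne j 0 with rfl | hj
      · simp
      · have : (j : ℝ) ≠ 0 := by exact_mod_cast hj
        push_cast; field_simp)
  filter_upwards [hsub, ae_abs_compensatedSum_sub_le (ν := ν) (ℱ := ℱ) hC] with ω h1 h2
  have hsqrt : Tendsto Nat.sqrt atTop atTop :=
    tendsto_atTop_mono' _ (Eventually.of_forall fun n => le_rfl)
      (tendsto_atTop_atTop.2 fun b => ⟨b * b, fun n hn => Nat.le_sqrt.2 hn⟩)
  -- Between consecutive squares there are at most `2 j` increments of size at most `2 C`; after
  -- division by `j ^ 2` they cost `4 C / j`.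
  have h3 : Tendsto (fun j : ℕ => |((j ^ 2 : ℕ) : ℝ)⁻¹ * compensatedSum ν ℱ Y (j ^ 2) ω| +
      4 * C * (1 / (j : ℝ))) atTop (𝓝 (0 + 4 * C * 0)) := by
    refine Tendsto.add ?_ (tendsto_const_nhds.mul tendsto_one_div_atTop_nhds_zero_nat)
    have := h1.sqrt
    simpa [Real.sqrt_sq_eq_abs] using this
  rw [mul_zero, add_zero] at h3
  refine squeeze_zero_norm' ?_ (h3.comp hsqrt)
  filter_upwards [eventually_gt_atTop 0] with n hn
  have hj : 0 < Nat.sqrt n := Nat.sqrt_pos.2 hn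
  obtain ⟨j, hjdef⟩ : ∃ j, j = Nat.sqrt n := ⟨_, rfl⟩
  rw [← hjdef] at hj
  have hjn : j ^ 2 ≤ n := by rw [sq, hjdef]; exact Nat.sqrt_le n
  have hjn2 : n ≤ j ^ 2 + 2 * j := by
    have := Nat.sqrt_le_add n
    rw [← hjdef] at this
    rw [sq]; omega
  have hb := h2 (j ^ 2) n hjn
  have hC0 : 0 ≤ C := (abs_nonneg _).trans (hC 0 ω)
  have hjR : (0 : ℝ) < j := by exact_mod_cast hj
  have hnR : (0 : ℝ) < n := by exact_mod_cast hn
  have hjnR : ((j ^ 2 : ℕ) : ℝ) ≤ n := by exact_mod_cast hjn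
  have hjn2R : (n : ℝ) - ((j ^ 2 : ℕ) : ℝ) ≤ 2 * j := by
    have : (n : ℝ) ≤ ((j ^ 2 : ℕ) : ℝ) + 2 * j := by exact_mod_cast hjn2
    linarith
  have hj2 : (0 : ℝ) < ((j ^ 2 : ℕ) : ℝ) := by positivity
  have hfin : |compensatedSum ν ℱ Y n ω| ≤ |compensatedSum ν ℱ Y (j ^ 2) ω| + 4 * C * j := by
    have e1 : ((n : ℝ) - ((j ^ 2 : ℕ) : ℝ)) * (2 * C) ≤ 2 * j * (2 * C) := by gcongr
    have e2 := abs_sub_abs_le_abs_sub (compensatedSum ν ℱ Y n ω) (compensatedSum ν ℱ Y (j ^ 2) ω)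
    linarith
  calc ‖(n : ℝ)⁻¹ * compensatedSum ν ℱ Y n ω‖
      = (n : ℝ)⁻¹ * |compensatedSum ν ℱ Y n ω| := by
        rw [norm_mul, norm_inv, Real.norm_eq_abs, Real.norm_eq_abs, abs_of_pos hnR]
    _ ≤ ((j ^ 2 : ℕ) : ℝ)⁻¹ * (|compensatedSum ν ℱ Y (j ^ 2) ω| + 4 * C * j) := by gcongr
    _ = _ := by
        simp only [Function.comp_apply]
        rw [← hjdef, abs_mul, abs_inv, abs_of_pos hj2, mul_add]
        congr 1
        push_cast
        field_simp

end Martingale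

/-! ### Bounded averages from a drift inequality and moments of order greater than one -/

section Truncation

variable {Ω : Type*} {mΩ : MeasurableSpace Ω} {ν : Measure Ω} {ℱ : Filtration ℕ mΩ}
  {Y : ℕ → Ω → ℝ}

/-- Split the square into the powers `2 - r` and `r`; bound the first factor by `R` and the second
by `y`. The restriction `r ≤ 2` makes the first power monotone. -/
lemma min_sq_le_mul_rpow {y R r : ℝ} (hy : 0 ≤ y) (hR : 0 < R) (hr1 : 1 < r) (hr2 : r ≤ 2) :
    min y R ^ 2 ≤ R ^ (2 - r) * y ^ r := by
  rcases hy.eq_or_lt with rfl | hy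
  · rw [min_eq_left hR.le, Real.zero_rpow (by linarith)]; simp
  have hm : 0 < min y R := lt_min hy hR
  have : min y R ^ 2 = min y R ^ (2 - r) * min y R ^ r := by
    rw [← Real.rpow_add hm, sub_add_cancel, Real.rpow_two]
  rw [this]
  gcongr
  · exact min_le_right _ _
  · exact min_le_left _ _

/-- A partial-sum bound along powers of two gives a bound on the running averages. -/
lemma exists_runningAvg_le_of_dyadic {a : ℕ → ℝ} (ha : ∀ k, 0 ≤ a k) {M : ℝ} (hM : 0 ≤ M)
    (h : ∀ᶠ j : ℕ in atTop, ∑ k ∈ Finset.range (2 ^ j), a k ≤ M * 2 ^ j) :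
    ∃ B, ∀ n, runningAvg a n ≤ B := by
  obtain ⟨J, hJ⟩ := eventually_atTop.1 h
  -- The first term serves `n ≤ 2 ^ J`; the second serves larger `n`, for which the next power of
  -- two is at most `2 n`.
  refine ⟨M * 2 ^ J + 2 * M, fun n => ?_⟩
  rcases Nat.eq_zero_or_pos n with rfl | hn
  · simp only [runningAvg, CharP.cast_eq_zero, inv_zero, zero_mul]; positivity
  have hnR : (1 : ℝ) ≤ n := by exact_mod_cast hn
  have hmono : ∀ {m m' : ℕ}, m ≤ m' → ∑ k ∈ Finset.range m, a k ≤ ∑ k ∈ Finset.range m', a k :=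
    fun hmm => Finset.sum_le_sum_of_subset_of_nonneg (Finset.range_mono hmm) fun k _ _ => ha k
  rw [runningAvg, inv_mul_le_iff₀ (by linarith)]
  rcases le_total n (2 ^ J) with hnJ | hnJ
  · have h1 := (hmono hnJ).trans (hJ J le_rfl)
    have : M * 2 ^ J ≤ n * (M * 2 ^ J) := le_mul_of_one_le_left (by positivity) hnR
    nlinarith
  · have hj : J ≤ Nat.log 2 n := Nat.le_log_of_pow_le one_lt_two hnJ
    have h1 := (hmono (Nat.lt_pow_succ_log_self one_lt_two n).le).trans (hJ (Nat.log 2 n + 1) (by omega))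
    have h2 : ((2 : ℝ) ^ Nat.log 2 n) ≤ n := by exact_mod_cast Nat.pow_log_le_self 2 hn.ne'
    have h3 : M * 2 ^ (Nat.log 2 n + 1) ≤ M * (2 * n) := by
      rw [pow_succ']; gcongr
    have : 0 ≤ n * (M * 2 ^ J) := by positivity
    nlinarith

/-- Running averages of a nonnegative adapted process stay bounded if the process has bounded
moments of some order `r > 1` and satisfies a drift inequality for truncated conditional
expectations. -/
lemma ae_exists_runningAvg_le_of_drift [IsProbabilityMeasure ν]
    (hY : ∀ n, StronglyMeasurable[ℱ n] (Y n)) (hY0 : ∀ n ω, 0 ≤ Y n ω) {r C : ℝ} (hr1 : 1 < r)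
    (hr2 : r ≤ 2) (hint : ∀ n, Integrable (fun ω => Y n ω ^ r) ν)
    (hmom : ∀ n, ∫ ω, Y n ω ^ r ∂ν ≤ C) {l : ℝ} (hl0 : 0 ≤ l) (hl1 : l < 1) {B : ℕ → Ω → ℝ}
    (hdrift : ∀ n R : ℕ, ν[fun ω => min (Y (n + 1) ω) R | ℱ n] ≤ᵐ[ν] fun ω => l * Y n ω + B n ω)
    (hB : ∀ᵐ ω ∂ν, ∃ β, ∀ n, runningAvg (fun k => B k ω) n ≤ β) :
    ∀ᵐ ω ∂ν, ∃ β, ∀ n, runningAvg (fun k => Y k ω) n ≤ β := by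
  have hC : 0 ≤ C := (integral_nonneg fun ω => Real.rpow_nonneg (hY0 0 ω) r).trans (hmom 0)
  set W : ℕ → ℕ → Ω → ℝ := fun R n ω => min (Y n ω) R with hWdef
  have hW : ∀ R n, StronglyMeasurable[ℱ n] (W R n) := fun R n =>
    (continuous_id.min continuous_const).comp_stronglyMeasurable (hY n)
  have hWR : ∀ R n ω, |W R n ω| ≤ R := fun R n ω => by
    rw [abs_of_nonneg (le_min (hY0 n ω) (Nat.cast_nonneg R))]
    exact min_le_right _ _
  have hq0 : (0 : ℝ) < 2 ^ (1 - r) := by positivity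
  have hq1 : (2 : ℝ) ^ (1 - r) < 1 := Real.rpow_lt_one_of_one_lt_of_neg one_lt_two (by linarith)
  have hsummable : Summable fun j : ℕ => C * ((2 : ℝ) ^ (1 - r)) ^ j :=
    (summable_geometric_of_lt_one hq0.le hq1).mul_left C
  have hpow : ∀ j : ℕ, ((2 : ℝ) ^ (1 - r)) ^ j = ((2 : ℝ) ^ j) ^ (1 - r) := fun j => by
    rw [← Real.rpow_natCast, ← Real.rpow_mul two_pos.le, mul_comm, Real.rpow_mul two_pos.le,
      Real.rpow_natCast]
  -- Truncating at `2 ^ j` over the first `2 ^ j` steps gives a variance of at most `2 ^ j * (2 ^ j)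
  -- ^ (2 - r) * C`; division by `(2 ^ j) ^ 2` leaves a geometric term since `r > 1`.
  have hS := ae_tendsto_zero_of_summable_integral (ν := ν)
    (f := fun j ω => ((2 ^ j : ℝ)⁻¹ * compensatedSum ν ℱ (W (2 ^ j)) (2 ^ j) ω) ^ 2)
    (c := fun j => C * ((2 : ℝ) ^ (1 - r)) ^ j)
    (fun j => by
      simp_rw [mul_pow]
      exact (integral_compensatedSum_sq_le (hW _) (hWR _) (2 ^ j)).1.const_mul _)
    (fun j ω => sq_nonneg _) hsummable
    (fun j => by
      simp_rw [mul_pow]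
      rw [integral_const_mul]
      have hj : (0 : ℝ) < 2 ^ j := by positivity
      have h1 := (integral_compensatedSum_sq_le (ν := ν) (hW (2 ^ j)) (hWR (2 ^ j)) (2 ^ j)).2
      have h2 : ∀ k ∈ Finset.range (2 ^ j), ∫ ω, W (2 ^ j) (k + 1) ω ^ 2 ∂ν ≤
          (2 ^ j : ℝ) ^ (2 - r) * C := fun k _ => by
        refine le_trans (integral_mono_of_nonneg (Eventually.of_forall fun ω => sq_nonneg _)
          ((hint (k + 1)).const_mul ((2 ^ j : ℝ) ^ (2 - r))) (Eventually.of_forall fun ω => ?_)) ?_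
        · simp only [hWdef]; push_cast
          exact min_sq_le_mul_rpow (hY0 _ ω) hj hr1 hr2
        · rw [integral_const_mul]
          exact mul_le_mul_of_nonneg_left (hmom _) (by positivity)
      have h3 := h1.trans (Finset.sum_le_card_nsmul _ _ _ h2)
      rw [Finset.card_range, nsmul_eq_mul] at h3
      push_cast at h3
      refine (mul_le_mul_of_nonneg_left h3 (by positivity)).trans (le_of_eq ?_)
      rw [hpow, show (2 : ℝ) - r = 1 + (1 - r) by ring, Real.rpow_add hj, Real.rpow_one]
      field_simp)
  -- Once this sum is below `1`, every `Y (k + 1)` with `k < 2 ^ j` is at most `2 ^ j`, so the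
  -- truncation is inactive.
  have hZ := ae_tendsto_zero_of_summable_integral (ν := ν)
    (f := fun j ω => (((2 : ℝ) ^ j) ^ r)⁻¹ * ∑ k ∈ Finset.range (2 ^ j), Y (k + 1) ω ^ r)
    (c := fun j => C * ((2 : ℝ) ^ (1 - r)) ^ j)
    (fun j => (integrable_finsetSum _ fun k _ => hint (k + 1)).const_mul _)
    (fun j ω => mul_nonneg (by positivity)
      (Finset.sum_nonneg fun k _ => Real.rpow_nonneg (hY0 _ ω) r)) hsummable
    (fun j => by
      have hj : (0 : ℝ) < 2 ^ j := by positivity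
      rw [integral_const_mul, integral_finsetSum _ fun k _ => hint (k + 1)]
      have h3 := Finset.sum_le_card_nsmul (Finset.range (2 ^ j))
        (fun k => ∫ ω, Y (k + 1) ω ^ r ∂ν) C fun k _ => hmom (k + 1)
      rw [Finset.card_range, nsmul_eq_mul] at h3
      push_cast at h3
      refine (mul_le_mul_of_nonneg_left h3 (by positivity)).trans (le_of_eq ?_)
      rw [hpow, Real.rpow_sub hj, Real.rpow_one]
      field_simp)
  have hd : ∀ᵐ ω ∂ν, ∀ n R : ℕ,
      (ν[fun ω => min (Y (n + 1) ω) R | ℱ n]) ω ≤ l * Y n ω + B n ω := by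
    rw [ae_all_iff]; intro n
    rw [ae_all_iff]; intro R
    exact hdrift n R
  filter_upwards [hS, hZ, hd, hB] with ω hS hZ hd ⟨β, hβ⟩
  have hl : 0 < 1 - l := by linarith
  -- With `A` the sum of the `Y (k + 1)`, the drift gives `A ≤ 2 ^ j + l (Y 0 + A) + |β| 2 ^ j`;
  -- solving for `A` and adding `Y 0` yields this `M`.
  refine exists_runningAvg_le_of_dyadic (fun k => hY0 k ω)
    (M := Y 0 ω + (1 + Y 0 ω + |β|) / (1 - l)) (by have := hY0 0 ω; positivity) ?_
  filter_upwards [hS.eventually (gt_mem_nhds one_pos), hZ.eventually (gt_mem_nhds one_pos)]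
    with j hSj hZj
  have hj : (0 : ℝ) < 2 ^ j := by positivity
  have hj1 : (1 : ℝ) ≤ 2 ^ j := one_le_pow₀ one_le_two
  have hYj : ∀ k ∈ Finset.range (2 ^ j), Y (k + 1) ω ≤ 2 ^ j := fun k hk => by
    by_contra! hlt
    have h1 : ((2 : ℝ) ^ j) ^ r ≤ Y (k + 1) ω ^ r := by gcongr
    have h2 : Y (k + 1) ω ^ r ≤ ∑ k ∈ Finset.range (2 ^ j), Y (k + 1) ω ^ r :=
      Finset.single_le_sum (f := fun k => Y (k + 1) ω ^ r)
        (fun k _ => Real.rpow_nonneg (hY0 _ ω) r) hk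
    rw [inv_mul_lt_iff₀ (by positivity), mul_one] at hZj
    linarith
  have hSle : compensatedSum ν ℱ (W (2 ^ j)) (2 ^ j) ω ≤ 2 ^ j := by
    have := (sq_lt_one_iff_abs_lt_one _).1 hSj
    have := (abs_lt.1 this).2
    rw [inv_mul_lt_iff₀ hj, mul_one] at this
    exact this.le
  set A := ∑ k ∈ Finset.range (2 ^ j), Y (k + 1) ω with hA
  have hA1 : A = compensatedSum ν ℱ (W (2 ^ j)) (2 ^ j) ω +
      ∑ k ∈ Finset.range (2 ^ j), (ν[W (2 ^ j) (k + 1) | ℱ k]) ω := by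
    rw [compensatedSum, ← Finset.sum_add_distrib]
    refine Finset.sum_congr rfl fun k hk => ?_
    rw [sub_add_cancel]
    simp only [hWdef]; push_cast
    rw [min_eq_left (hYj k hk)]
  have hA2 : ∑ k ∈ Finset.range (2 ^ j), (ν[W (2 ^ j) (k + 1) | ℱ k]) ω ≤
      l * ∑ k ∈ Finset.range (2 ^ j), Y k ω + ∑ k ∈ Finset.range (2 ^ j), B k ω := by
    rw [Finset.mul_sum, ← Finset.sum_add_distrib]
    exact Finset.sum_le_sum fun k _ => hd k (2 ^ j)
  have hYA : ∑ k ∈ Finset.range (2 ^ j), Y k ω ≤ Y 0 ω + A := by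
    have h1 := Finset.sum_range_succ' (fun k => Y k ω) (2 ^ j)
    have h2 := Finset.sum_range_succ (fun k => Y k ω) (2 ^ j)
    have h3 := hY0 (2 ^ j) ω
    linarith
  have hBj : ∑ k ∈ Finset.range (2 ^ j), B k ω ≤ |β| * 2 ^ j := by
    have := hβ (2 ^ j)
    rw [runningAvg, inv_mul_le_iff₀ (by positivity)] at this
    push_cast at this
    nlinarith [le_abs_self β]
  have hY00 := hY0 0 ω
  have hAle : A ≤ (1 + Y 0 ω + |β|) / (1 - l) * 2 ^ j := by
    rw [div_mul_eq_mul_div, le_div_iff₀ hl]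
    have h1 : l * ∑ k ∈ Finset.range (2 ^ j), Y k ω ≤ l * (Y 0 ω + A) := by gcongr
    have h2 : l * Y 0 ω ≤ Y 0 ω * 2 ^ j := by nlinarith
    nlinarith
  nlinarith

end Truncation

/-! ### The one-step operator of interacting tempering -/

section Operator

/-- This form shows that the current state enters only through `q x`, that the dependence is
antitone, and that `q z / Q` is a lower bound when `q ≤ Q`. -/
lemma acceptProb_eq_div_max {S : Type*} {p : S → ℝ} (hp : ∀ x, 0 < p x) (T T' : ℝ) (x z : S) :
    acceptProb p T T' x z =
      p z ^ (1 / T - 1 / T') / max (p z ^ (1 / T - 1 / T')) (p x ^ (1 / T - 1 / T')) := by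
  have hz := Real.rpow_pos_of_pos (hp z) (1 / T - 1 / T')
  have hx := Real.rpow_pos_of_pos (hp x) (1 / T - 1 / T')
  rw [acceptProb, show 1 / T' - 1 / T = -(1 / T - 1 / T') by ring,
    Real.rpow_neg (div_nonneg (hp x).le (hp z).le), Real.div_rpow (hp x).le (hp z).le, inv_div]
  rcases le_total (p z ^ (1 / T - 1 / T')) (p x ^ (1 / T - 1 / T')) with h | h
  · rw [max_eq_right h, min_eq_right ((div_le_one hx).2 h)]
  · rw [max_eq_left h, div_self hz.ne', min_eq_left ((one_le_div hx).2 h)]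

variable {S : Type*} [MeasurableSpace S]

/-- The average of `f` against `θ`, weighted by the probability `q z / max (q z) t` of accepting a
swap to `z` from a state `x` with `q x = t`. -/
def swapAvg (q : S → ℝ) (θ : Measure S) (f : S → ℝ) (t : ℝ) : ℝ :=
  ∫ z, q z / max (q z) t * f z ∂θ

/-- The operator `f ↦ P_θ f` of the interacting tempering step. -/
def temperOp (υ : ℝ) (P : Kernel S S) (q : S → ℝ) (θ : Measure S) (f : S → ℝ) (x : S) : ℝ :=
  (1 - υ) * ∫ y, f y ∂(P x) +
    υ * (swapAvg q θ f (q x) + (1 - swapAvg q θ (fun _ => 1) (q x)) * f x)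

variable {q : S → ℝ} {θ : Measure S} {f : S → ℝ} {C : ℝ}

lemma div_max_mem_Icc {a : ℝ} (ha : 0 < a) (t : ℝ) : a / max a t ∈ Set.Icc (0 : ℝ) 1 :=
  ⟨div_nonneg ha.le (ha.le.trans (le_max_left _ _)),
    div_le_one_of_le₀ (le_max_left _ _) (ha.le.trans (le_max_left _ _))⟩

lemma measurable_div_max (hq : Measurable q) (t : ℝ) : Measurable fun z => q z / max (q z) t :=
  hq.div (hq.max measurable_const)

lemma integrable_div_max_mul [IsFiniteMeasure θ] (hq : Measurable q) (hq0 : ∀ x, 0 < q x)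
    (hf : Integrable f θ) (t : ℝ) : Integrable (fun z => q z / max (q z) t * f z) θ := by
  refine hf.bdd_mul (c := 1) (measurable_div_max hq t).aestronglyMeasurable
    (Eventually.of_forall fun z => ?_)
  rw [Real.norm_eq_abs, abs_of_nonneg (div_max_mem_Icc (hq0 z) t).1]
  exact (div_max_mem_Icc (hq0 z) t).2

lemma integrable_of_bounded [IsFiniteMeasure θ] (hf : Measurable f) (hC : ∀ x, |f x| ≤ C) :
    Integrable f θ :=
  Integrable.of_bound hf.aestronglyMeasurable C (Eventually.of_forall hC)

/-- Passage from measures to real integrals; the rest of the argument only sees `temperOp`. -/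
lemma integral_stepLaw {υ : ℝ} (hυ : υ ∈ Set.Ioo (0 : ℝ) 1) {P : Kernel S S} [IsMarkovKernel P]
    [IsProbabilityMeasure θ] {p : S → ℝ} (hp : ∀ x, 0 < p x) (hpm : Measurable p) (T T' : ℝ)
    (hf : Measurable f) (hC : ∀ x, |f x| ≤ C) (x : S) :
    ∫ y, f y ∂(stepLaw υ P p T T' θ x) =
      temperOp υ P (fun z => p z ^ (1 / T - 1 / T')) θ f x := by
  set q : S → ℝ := fun z => p z ^ (1 / T - 1 / T') with hq
  have hq0 : ∀ z, 0 < q z := fun z => Real.rpow_pos_of_pos (hp z) _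
  have hqm : Measurable q := hpm.pow_const _
  have hα : ∀ z, acceptProb p T T' x z = q z / max (q z) (q x) := fun z =>
    acceptProb_eq_div_max hp T T' x z
  have hαm : Measurable fun z => q z / max (q z) (q x) := measurable_div_max hqm (q x)
  have hI : ∀ z, q z / max (q z) (q x) ∈ Set.Icc (0 : ℝ) 1 := fun z => div_max_mem_Icc (hq0 z) _
  have hfP : Integrable f (P x) := integrable_of_bounded hf hC
  have hfθ : Integrable f θ := integrable_of_bounded hf hC
  have h1θ : Integrable (fun z => q z / max (q z) (q x)) θ := by
    simpa using integrable_div_max_mul hqm hq0 (integrable_const (1 : ℝ)) (q x)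
  have hrej : ∫⁻ z, ENNReal.ofReal (1 - acceptProb p T T' x z) ∂θ =
      ENNReal.ofReal (1 - swapAvg q θ (fun _ => 1) (q x)) := by
    simp_rw [hα]
    have h1 : Integrable (fun z => 1 - q z / max (q z) (q x)) θ := (integrable_const _).sub h1θ
    rw [← ofReal_integral_eq_lintegral_ofReal h1
      (Eventually.of_forall fun z => sub_nonneg.2 (hI z).2), integral_sub (integrable_const _) h1θ]
    simp [swapAvg]
  have hrej0 : 0 ≤ 1 - swapAvg q θ (fun _ => 1) (q x) := by
    have := integral_mono h1θ (integrable_const (1 : ℝ)) fun z => (hI z).2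
    simp only [integral_const, probReal_univ, smul_eq_mul, mul_one] at this
    simpa [swapAvg] using this
  have hwd : Integrable f (θ.withDensity fun z => ENNReal.ofReal (acceptProb p T T' x z)) := by
    simp_rw [hα]
    rw [integrable_withDensity_iff_integrable_smul' hαm.ennreal_ofReal (by simp)]
    simp_rw [ENNReal.toReal_ofReal (hI _).1, smul_eq_mul]
    exact integrable_div_max_mul hqm hq0 hfθ _
  have hdir : Integrable f ((∫⁻ z, ENNReal.ofReal (1 - acceptProb p T T' x z) ∂θ) •
      Measure.dirac x) :=
    (integrable_of_bounded hf hC : Integrable f (Measure.dirac x)).smul_measure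
      (by rw [hrej]; exact ENNReal.ofReal_ne_top)
  rw [stepLaw, interactionLaw, integral_add_measure (hfP.smul_measure ENNReal.ofReal_ne_top)
    ((hwd.add_measure hdir).smul_measure ENNReal.ofReal_ne_top), integral_smul_measure,
    integral_smul_measure, integral_add_measure hwd hdir, integral_smul_measure,
    integral_dirac' _ _ hf.stronglyMeasurable, hrej, ENNReal.toReal_ofReal hrej0,
    ENNReal.toReal_ofReal hυ.1.le, ENNReal.toReal_ofReal (by linarith [hυ.2])]
  simp_rw [hα]
  rw [integral_withDensity_eq_integral_toReal_smul hαm.ennreal_ofReal (by simp)]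
  simp_rw [ENNReal.toReal_ofReal (hI _).1]
  rfl

lemma swapAvg_mono [IsFiniteMeasure θ] (hq : Measurable q) (hq0 : ∀ x, 0 < q x) {g : S → ℝ}
    (hf : Integrable f θ) (hg : Integrable g θ) (h : ∀ x, f x ≤ g x) (t : ℝ) :
    swapAvg q θ f t ≤ swapAvg q θ g t :=
  integral_mono (integrable_div_max_mul hq hq0 hf t) (integrable_div_max_mul hq hq0 hg t)
    fun z => mul_le_mul_of_nonneg_left (h z) (div_max_mem_Icc (hq0 z) t).1

lemma swapAvg_const (c t : ℝ) : swapAvg q θ (fun _ => c) t = c * swapAvg q θ (fun _ => 1) t := by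
  simp only [swapAvg, mul_one]
  rw [integral_mul_const, mul_comm]

lemma swapAvg_add_const [IsFiniteMeasure θ] (hq : Measurable q) (hq0 : ∀ x, 0 < q x)
    (hf : Integrable f θ) (c t : ℝ) :
    swapAvg q θ (fun x => f x + c) t = swapAvg q θ f t + c * swapAvg q θ (fun _ => 1) t := by
  rw [← swapAvg_const c t, swapAvg, swapAvg, swapAvg, ← integral_add
    (integrable_div_max_mul hq hq0 hf t) (integrable_div_max_mul hq hq0 (integrable_const c) t)]
  simp_rw [mul_add]

/-- A larger `t` enlarges the denominator; the sign of `f` is needed to keep the order. This is the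
monotonicity fed to Pólya's theorem. -/
lemma antitone_swapAvg [IsFiniteMeasure θ] (hq : Measurable q) (hq0 : ∀ x, 0 < q x)
    (hf : Integrable f θ) (hf0 : ∀ x, 0 ≤ f x) : Antitone (swapAvg q θ f) := by
  intro s t hst
  refine integral_mono (integrable_div_max_mul hq hq0 hf t) (integrable_div_max_mul hq hq0 hf s)
    fun z => mul_le_mul_of_nonneg_right ?_ (hf0 z)
  exact div_le_div_of_nonneg_left (hq0 z).le (lt_of_lt_of_le (hq0 z) (le_max_left _ _))
    (max_le_max le_rfl hst)

lemma continuous_swapAvg [IsFiniteMeasure θ] (hq : Measurable q) (hq0 : ∀ x, 0 < q x)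
    (hf : Integrable f θ) : Continuous (swapAvg q θ f) := by
  refine continuous_of_dominated (bound := fun z => |f z|)
    (fun t => (integrable_div_max_mul hq hq0 hf t).1) (fun t => Eventually.of_forall fun z => ?_)
    hf.abs (Eventually.of_forall fun z => ?_)
  · rw [norm_mul, Real.norm_eq_abs, Real.norm_eq_abs,
      abs_of_nonneg (div_max_mem_Icc (hq0 z) t).1]
    exact mul_le_of_le_one_left (abs_nonneg _) (div_max_mem_Icc (hq0 z) t).2
  · exact (continuous_const.div (continuous_const.max continuous_id)
      fun t => (lt_of_lt_of_le (hq0 z) (le_max_left _ _)).ne').mul continuous_const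

lemma swapAvg_one_mem_Icc [IsProbabilityMeasure θ] (hq : Measurable q) (hq0 : ∀ x, 0 < q x)
    (t : ℝ) : swapAvg q θ (fun _ => 1) t ∈ Set.Icc (0 : ℝ) 1 := by
  refine ⟨integral_nonneg fun z => ?_, ?_⟩
  · rw [mul_one]; exact (div_max_mem_Icc (hq0 z) t).1
  · have := integral_mono (integrable_div_max_mul hq hq0 (integrable_const (1 : ℝ)) t)
      (integrable_const (1 : ℝ)) (μ := θ) fun z => by
        rw [mul_one]; exact (div_max_mem_Icc (hq0 z) t).2
    simpa [swapAvg] using this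

variable {υ : ℝ} {P : Kernel S S}

/-- Uniform Doeblin minorisation: `P_θ` contracts the oscillation, because a swap is accepted
with probability at least `q z / Q` whatever the current state. -/
lemma temperOp_contracts [IsMarkovKernel P] [IsProbabilityMeasure θ]
    (hυ : υ ∈ Set.Ioo (0 : ℝ) 1) (hq : Measurable q) (hq0 : ∀ x, 0 < q x) {Q : ℝ}
    (hqQ : ∀ x, q x ≤ Q) (hf : Measurable f) {m r : ℝ} (hm : ∀ x, m ≤ f x)
    (hr : ∀ x, f x ≤ m + r) :
    ∃ m', ∀ x, m' ≤ temperOp υ P q θ f x ∧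
      temperOp υ P q θ f x ≤ m' + (1 - υ * ∫ z, q z / Q ∂θ) * r := by
  have hC : ∀ x, |f x| ≤ max |m| |m + r| := fun x => abs_le_max_abs_abs (hm x) (hr x)
  have hfθ : Integrable f θ := integrable_of_bounded hf hC
  have hw : ∀ z, q z / Q ∈ Set.Icc (0 : ℝ) 1 := fun z => by
    have hQ : 0 < Q := (hq0 z).trans_le (hqQ z)
    exact ⟨div_nonneg (hq0 z).le hQ.le, (div_le_one hQ).2 (hqQ z)⟩
  have hwm : Measurable fun z => q z / Q := hq.div_const Q
  have hwb : ∀ z, ‖q z / Q‖ ≤ 1 := fun z => by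
    rw [Real.norm_eq_abs, abs_of_nonneg (hw z).1]; exact (hw z).2
  have hwi : Integrable (fun z => q z / Q) θ :=
    Integrable.of_bound hwm.aestronglyMeasurable 1 (Eventually.of_forall hwb)
  have hwf : Integrable (fun z => q z / Q * f z) θ :=
    hfθ.bdd_mul hwm.aestronglyMeasurable (Eventually.of_forall hwb)
  -- The component `υ (q / Q) θ` is common to all `x` and contributes the first term; the remaining
  -- mass integrates values in `[m, m + r]`.
  refine ⟨υ * ∫ z, q z / Q * f z ∂θ + m * (1 - υ * ∫ z, q z / Q ∂θ), fun x => ?_⟩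
  have hle : ∀ z, q z / Q ≤ q z / max (q z) (q x) := fun z =>
    div_le_div_of_nonneg_left (hq0 z).le (lt_of_lt_of_le (hq0 z) (le_max_left _ _))
      (max_le (hqQ z) (hqQ x))
  have hα1 : Integrable (fun z => q z / max (q z) (q x)) θ := by
    simpa using integrable_div_max_mul hq hq0 (integrable_const (1 : ℝ)) (q x)
  have hαf := integrable_div_max_mul hq hq0 hfθ (q x)
  set a := swapAvg q θ (fun _ => 1) (q x) with ha
  have ha1 : a = ∫ z, q z / max (q z) (q x) ∂θ := by simp [ha, swapAvg]
  have haI : a ∈ Set.Icc (0 : ℝ) 1 := swapAvg_one_mem_Icc hq hq0 (q x)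
  have hP1 : m ≤ ∫ y, f y ∂(P x) := by
    have := integral_mono (μ := P x) (integrable_const m) (integrable_of_bounded hf hC) hm
    simpa using this
  have hP2 : ∫ y, f y ∂(P x) ≤ m + r := by
    have := integral_mono (μ := P x) (integrable_of_bounded hf hC) (integrable_const (m + r)) hr
    simpa using this
  have hsub : ∀ c, ∫ z, (q z / max (q z) (q x) - q z / Q) * c ∂θ = (a - ∫ z, q z / Q ∂θ) * c :=
    fun c => by rw [integral_mul_const, integral_sub hα1 hwi, ha1]
  have hdiff : ∫ z, (q z / max (q z) (q x) - q z / Q) * f z ∂θ =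
      swapAvg q θ f (q x) - ∫ z, q z / Q * f z ∂θ := by
    simp_rw [sub_mul]
    rw [integral_sub hαf hwf]; rfl
  have hdi : Integrable (fun z => (q z / max (q z) (q x) - q z / Q) * f z) θ := by
    simp_rw [sub_mul]; exact hαf.sub hwf
  have hS1 : (a - ∫ z, q z / Q ∂θ) * m ≤ swapAvg q θ f (q x) - ∫ z, q z / Q * f z ∂θ := by
    rw [← hsub, ← hdiff]
    exact integral_mono ((hα1.sub hwi).mul_const m) hdi fun z =>
      mul_le_mul_of_nonneg_left (hm z) (sub_nonneg.2 (hle z))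
  have hS2 : swapAvg q θ f (q x) - ∫ z, q z / Q * f z ∂θ ≤
      (a - ∫ z, q z / Q ∂θ) * (m + r) := by
    rw [← hsub, ← hdiff]
    exact integral_mono hdi ((hα1.sub hwi).mul_const (m + r)) fun z =>
      mul_le_mul_of_nonneg_left (hr z) (sub_nonneg.2 (hle z))
  have hR1 : (1 - a) * m ≤ (1 - a) * f x := mul_le_mul_of_nonneg_left (hm x) (by linarith [haI.2])
  have hR2 : (1 - a) * f x ≤ (1 - a) * (m + r) :=
    mul_le_mul_of_nonneg_left (hr x) (by linarith [haI.2])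
  have hυ1 : 0 ≤ 1 - υ := by linarith [hυ.2]
  have e1 := mul_le_mul_of_nonneg_left hP1 hυ1
  have e2 := mul_le_mul_of_nonneg_left hP2 hυ1
  have e3 := mul_le_mul_of_nonneg_left (add_le_add hS1 hR1) hυ.1.le
  have e4 := mul_le_mul_of_nonneg_left (add_le_add hS2 hR2) hυ.1.le
  constructor <;> · unfold temperOp; nlinarith

lemma abs_temperOp_le [IsMarkovKernel P] [IsProbabilityMeasure θ]
    (hυ : υ ∈ Set.Ioo (0 : ℝ) 1) (hq : Measurable q) (hq0 : ∀ x, 0 < q x)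
    (hf : Measurable f) (hC : ∀ x, |f x| ≤ C) (x : S) : |temperOp υ P q θ f x| ≤ C := by
  have hfP : |∫ y, f y ∂(P x)| ≤ C := by
    have := norm_integral_le_of_norm_le_const (μ := P x) (f := f) (Eventually.of_forall hC)
    simpa using this
  have haI := swapAvg_one_mem_Icc (θ := θ) hq hq0 (q x)
  have hfθ : Integrable f θ := integrable_of_bounded hf hC
  have h1 := swapAvg_mono hq hq0 hfθ (integrable_const C) (fun z => (abs_le.1 (hC z)).2) (q x)
  have h2 := swapAvg_mono hq hq0 (integrable_const (-C)) hfθ (fun z => (abs_le.1 (hC z)).1) (q x)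
  rw [swapAvg_const] at h1 h2
  have h3 := abs_le.1 (hC x)
  have h4 := abs_le.1 hfP
  set a := swapAvg q θ (fun _ => 1) (q x)
  have hυ1 : 0 ≤ 1 - υ := by linarith [hυ.2]
  have ha1 : 0 ≤ 1 - a := by linarith [haI.2]
  have e1 := mul_le_mul_of_nonneg_left h4.1 hυ1
  have e2 := mul_le_mul_of_nonneg_left h4.2 hυ1
  have e3 := mul_le_mul_of_nonneg_left (add_le_add h1 (mul_le_mul_of_nonneg_left h3.2 ha1)) hυ.1.le
  have e4 := mul_le_mul_of_nonneg_left (add_le_add h2 (mul_le_mul_of_nonneg_left h3.1 ha1)) hυ.1.le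
  rw [abs_le]
  constructor <;> · unfold temperOp; nlinarith

/-- The kernel part cancels, so two proposals are compared through swap averages at `q x` only. -/
lemma temperOp_sub_eq (θ θ' : Measure S) (x : S) :
    temperOp υ P q θ f x - temperOp υ P q θ' f x =
      υ * ((swapAvg q θ f (q x) - swapAvg q θ' f (q x)) -
        (swapAvg q θ (fun _ => 1) (q x) - swapAvg q θ' (fun _ => 1) (q x)) * f x) := by
  unfold temperOp; ring

/-- Drift inequality for truncations: `P_θ (W ∧ R) ≤ l' W + b' + υ θ(W ∧ R)`. -/
lemma temperOp_min_le [IsMarkovKernel P] [IsProbabilityMeasure θ]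
    (hυ : υ ∈ Set.Ioo (0 : ℝ) 1) (hq : Measurable q) (hq0 : ∀ x, 0 < q x) {W : S → ℝ}
    (hW : Measurable W) (hW0 : ∀ x, 0 ≤ W x) {l : ℝ} (hl : 0 ≤ l) {b : ℝ≥0}
    (hd : ∀ x, ∫⁻ y, ENNReal.ofReal (W y) ∂(P x) ≤ ENNReal.ofReal (l * W x) + b) {R : ℝ}
    (hR : 0 ≤ R) (x : S) :
    temperOp υ P q θ (fun y => min (W y) R) x ≤
      ((1 - υ) * l + υ) * W x + ((1 - υ) * b + υ * ∫ z, min (W z) R ∂θ) := by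
  have hm : Measurable fun y => min (W y) R := hW.min measurable_const
  have hm0 : ∀ y, 0 ≤ min (W y) R := fun y => le_min (hW0 y) hR
  have hmR : ∀ y, |min (W y) R| ≤ R := fun y => by
    rw [abs_of_nonneg (hm0 y)]; exact min_le_right _ _
  have hP : ∫ y, min (W y) R ∂(P x) ≤ l * W x + b := by
    have h0 : 0 ≤ l * W x := mul_nonneg hl (hW0 x)
    rw [← ENNReal.ofReal_le_ofReal_iff (by positivity),
      ofReal_integral_eq_lintegral_ofReal (integrable_of_bounded hm hmR)
        (Eventually.of_forall hm0), ENNReal.ofReal_add h0 b.coe_nonneg, ENNReal.ofReal_coe_nnreal]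
    exact (lintegral_mono fun y => ENNReal.ofReal_le_ofReal (min_le_left _ _)).trans (hd x)
  have hS : swapAvg q θ (fun y => min (W y) R) (q x) ≤ ∫ z, min (W z) R ∂θ := by
    refine integral_mono (integrable_div_max_mul hq hq0 (integrable_of_bounded hm hmR) _)
      (integrable_of_bounded hm hmR) fun z => ?_
    exact mul_le_of_le_one_left (hm0 z) (div_max_mem_Icc (hq0 z) _).2
  have haI := swapAvg_one_mem_Icc (θ := θ) hq hq0 (q x)
  have hrej : (1 - swapAvg q θ (fun _ => 1) (q x)) * min (W x) R ≤ W x :=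
    (mul_le_of_le_one_left (hm0 x) (by linarith [haI.1])).trans (min_le_left _ _)
  have hυ1 : 0 ≤ 1 - υ := by linarith [hυ.2]
  have e1 := mul_le_mul_of_nonneg_left hP hυ1
  have e2 := mul_le_mul_of_nonneg_left (add_le_add hS hrej) hυ.1.le
  unfold temperOp
  nlinarith

end Operator

/-! ### Integrals against the empirical measure -/

section EmpiricalMeasure

variable {S Ω : Type*} [MeasurableSpace S] (Y : ℕ → Ω → S) (n : ℕ) (ω : Ω)

instance : IsProbabilityMeasure (empiricalMeasure Y n ω) where
  measure_univ := by
    simp only [empiricalMeasure, Measure.smul_apply, Measure.finsetSum_apply, measure_univ,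
      Finset.sum_const, Finset.card_range, smul_eq_mul, nsmul_eq_mul, mul_one]
    push_cast
    exact ENNReal.inv_mul_cancel (by simp) (by finiteness)

lemma integral_empiricalMeasure {f : S → ℝ} (hf : Measurable f) :
    ∫ z, f z ∂(empiricalMeasure Y n ω) = runningAvg (fun l => f (Y l ω)) (n + 1) := by
  have hi : ∀ l ∈ Finset.range (n + 1), Integrable f (Measure.dirac (Y l ω)) := fun l _ => by
    refine ⟨hf.aestronglyMeasurable, ?_⟩
    rw [HasFiniteIntegral, lintegral_dirac' _ hf.enorm]
    exact enorm_lt_top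
  rw [empiricalMeasure, integral_smul_measure, integral_finsetSum_measure hi, runningAvg]
  simp_rw [integral_dirac' _ _ hf.stronglyMeasurable]
  rw [ENNReal.toReal_inv, smul_eq_mul, ENNReal.toReal_add (by finiteness) (by finiteness)]
  simp

end EmpiricalMeasure

/-! ### The limiting operator -/

section Limit

lemma integral_kernel_of_invariant {S : Type*} [MeasurableSpace S] {P : Kernel S S} {ρ : Measure S}
    {f : S → ℝ} [IsProbabilityMeasure ρ] [IsMarkovKernel P]
    (hP : Kernel.Invariant P ρ) (hf : Integrable f ρ) :
    ∫ x, ∫ y, f y ∂(P x) ∂ρ = ∫ x, f x ∂ρ := by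
  have hb : ρ = (P ∘ₖ Kernel.const Unit ρ) () := by
    rw [← Measure.comp_eq_comp_const_apply]; exact hP.def.symm
  have := Kernel.integral_comp (κ := Kernel.const Unit ρ) (η := P) (a := ()) (f := f)
    (by rwa [← hb])
  rw [← hb, Kernel.const_apply] at this
  exact this.symm

variable {S : Type*} [TopologicalSpace S] [MeasurableSpace S] [BorelSpace S]
  {υ : ℝ} {P : Kernel S S} {q : S → ℝ} {θ ρ : Measure S} {f : S → ℝ} {C : ℝ}

/-- The Feller property handles `P`, and the swap part is a continuous function of `q x`. Iterates
of the operator thus remain admissible test functions. -/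
lemma continuous_temperOp [IsProbabilityMeasure θ] (hP : IsFeller P) (hq : Continuous q)
    (hq0 : ∀ x, 0 < q x) (hf : Continuous f) (hC : ∀ x, |f x| ≤ C) :
    Continuous (temperOp υ P q θ f) := by
  have h1 : Continuous fun x => ∫ y, f y ∂(P x) :=
    hP (BoundedContinuousFunction.ofNormedAddCommGroup f hf C hC)
  have h2 := (continuous_swapAvg hq.measurable hq0
    (integrable_of_bounded hf.measurable hC : Integrable f θ)).comp hq
  have h3 := (continuous_swapAvg hq.measurable hq0 (integrable_const (1 : ℝ) (μ := θ))).comp hq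
  exact (continuous_const.mul h1).add
    (continuous_const.mul (h2.add ((continuous_const.sub h3).mul hf)))

/-- The limiting operator preserves `ρ` if `P` does and if the swap proposal `θ` has density
proportional to `q⁻¹` with respect to `ρ`. -/
lemma integral_temperOp [SecondCountableTopology S] [IsProbabilityMeasure ρ]
    [IsProbabilityMeasure θ] [IsMarkovKernel P] (hP : Kernel.Invariant P ρ) (hq : Continuous q)
    (hq0 : ∀ x, 0 < q x) {c : ℝ} (hθ : ∀ h : S → ℝ, ∫ z, h z ∂θ = c * ∫ z, (q z)⁻¹ * h z ∂ρ)
    (hqi : Integrable (fun z => (q z)⁻¹) ρ) (hf : Continuous f) (hC : ∀ x, |f x| ≤ C) :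
    ∫ x, temperOp υ P q θ f x ∂ρ = ∫ x, f x ∂ρ := by
  have hmax : ∀ x z, 0 < max (q z) (q x) := fun x z => lt_of_lt_of_le (hq0 z) (le_max_left _ _)
  have hswap : ∀ (h : S → ℝ) (x : S), swapAvg q θ h (q x) =
      c * ∫ z, (max (q z) (q x))⁻¹ * h z ∂ρ := fun h x => by
    rw [swapAvg, hθ]
    congr 2; ext z
    have := (hq0 z).ne'
    have := (hmax x z).ne'
    field_simp
  have hfi : Integrable f ρ := integrable_of_bounded hf.measurable hC
  have hk : Integrable (Function.uncurry fun x z => (max (q z) (q x))⁻¹ * f z) (ρ.prod ρ) := by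
    have hdom : Integrable (fun w : S × S => C * (q w.2)⁻¹) (ρ.prod ρ) :=
      (hqi.comp_snd ρ).const_mul C
    refine hdom.mono' ?_ (Eventually.of_forall fun ⟨x, z⟩ => ?_)
    · refine Continuous.aestronglyMeasurable ?_
      refine Continuous.mul (Continuous.inv₀ ?_ fun w => (hmax w.1 w.2).ne') (hf.comp continuous_snd)
      exact (hq.comp continuous_snd).max (hq.comp continuous_fst)
    · simp only [Function.uncurry]
      rw [norm_mul, norm_inv, Real.norm_eq_abs, Real.norm_eq_abs, abs_of_pos (hmax x z), mul_comm]
      have h1 : (max (q z) (q x))⁻¹ ≤ (q z)⁻¹ := inv_anti₀ (hq0 z) (le_max_left _ _)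
      exact mul_le_mul (hC z) h1 (inv_nonneg.2 (hmax x z).le) ((abs_nonneg _).trans (hC z))
  -- Detailed balance: the kernel `1 / max (q z) (q x)` is symmetric, so Fubini exchanges the mass
  -- moved in with the mass moved out.
  have hsym : ∫ x, swapAvg q θ f (q x) ∂ρ = ∫ x, swapAvg q θ (fun _ => 1) (q x) * f x ∂ρ := by
    simp_rw [hswap, mul_one]
    rw [integral_const_mul, integral_integral_swap hk]
    simp_rw [integral_mul_const, mul_assoc]
    rw [integral_const_mul]
    simp_rw [max_comm]
  have hi1 : Integrable (fun x => ∫ y, f y ∂(P x)) ρ := by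
    refine Integrable.of_bound
      hf.measurable.stronglyMeasurable.integral_kernel.aestronglyMeasurable C
      (Eventually.of_forall fun x => ?_)
    simpa using norm_integral_le_of_norm_le_const (μ := P x) (f := f) (Eventually.of_forall hC)
  have hi2 : Integrable (fun x => swapAvg q θ f (q x)) ρ := by
    refine Integrable.of_bound
      (((continuous_swapAvg hq.measurable hq0
        (integrable_of_bounded hf.measurable hC)).comp hq).aestronglyMeasurable) C
      (Eventually.of_forall fun x => ?_)
    have := norm_integral_le_of_norm_le_const (μ := θ) (f := fun z => q z / max (q z) (q x) * f z)
      (C := C) (Eventually.of_forall fun z => by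
        rw [norm_mul, Real.norm_eq_abs, Real.norm_eq_abs,
          abs_of_nonneg (div_max_mem_Icc (hq0 z) _).1]
        exact (mul_le_of_le_one_left (abs_nonneg _) (div_max_mem_Icc (hq0 z) _).2).trans (hC z))
    simpa [swapAvg] using this
  have hi3 : Integrable (fun x => swapAvg q θ (fun _ => 1) (q x) * f x) ρ := by
    refine hfi.bdd_mul (c := 1) (((continuous_swapAvg hq.measurable hq0
        (integrable_const 1)).comp hq).aestronglyMeasurable) (Eventually.of_forall fun x => ?_)
    have := swapAvg_one_mem_Icc (θ := θ) hq.measurable hq0 (q x)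
    rw [Real.norm_eq_abs, abs_of_nonneg this.1]; exact this.2
  have hexp : ∀ x, temperOp υ P q θ f x = (1 - υ) * ∫ y, f y ∂(P x) + υ * (swapAvg q θ f (q x) +
      (f x - swapAvg q θ (fun _ => 1) (q x) * f x)) := fun x => by unfold temperOp; ring
  simp_rw [hexp]
  have hi4 : Integrable (fun x => f x - swapAvg q θ (fun _ => 1) (q x) * f x) ρ := hfi.sub hi3
  have hi5 : Integrable (fun x => swapAvg q θ f (q x) +
    (f x - swapAvg q θ (fun _ => 1) (q x) * f x)) ρ := hi2.add hi4
  rw [integral_add (hi1.const_mul _) (hi5.const_mul _), integral_const_mul, integral_const_mul,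
    integral_add hi2 hi4, integral_sub hfi hi3, integral_kernel_of_invariant hP hfi, hsym]
  ring

/-- Geometric convergence of the iterates of the limiting operator, uniformly in the state. -/
lemma temperOp_iterate [SecondCountableTopology S] [IsProbabilityMeasure ρ]
    [IsProbabilityMeasure θ] [IsMarkovKernel P] (hυ : υ ∈ Set.Ioo (0 : ℝ) 1)
    (hFeller : IsFeller P) (hP : Kernel.Invariant P ρ) (hq : Continuous q)
    (hq0 : ∀ x, 0 < q x) {Q : ℝ} (hqQ : ∀ x, q x ≤ Q)
    {c : ℝ} (hθ : ∀ h : S → ℝ, ∫ z, h z ∂θ = c * ∫ z, (q z)⁻¹ * h z ∂ρ)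
    (hqi : Integrable (fun z => (q z)⁻¹) ρ) (hf : Continuous f) (hC : ∀ x, |f x| ≤ C) (N : ℕ) :
    Continuous ((temperOp υ P q θ)^[N] f) ∧ (∀ x, |(temperOp υ P q θ)^[N] f x| ≤ C) ∧
      ∀ x, |(temperOp υ P q θ)^[N] f x - ∫ x, f x ∂ρ| ≤
        (1 - υ * ∫ z, q z / Q ∂θ) ^ N * (2 * C) := by
  -- The induction tracks an interval containing all values and the preserved `ρ`-mean. The mean
  -- lies in the interval, so the width bounds the deviation from it.
  suffices h : Continuous ((temperOp υ P q θ)^[N] f) ∧ (∀ x, |(temperOp υ P q θ)^[N] f x| ≤ C) ∧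
      (∫ x, (temperOp υ P q θ)^[N] f x ∂ρ = ∫ x, f x ∂ρ) ∧
      ∃ m, ∀ x, m ≤ (temperOp υ P q θ)^[N] f x ∧
        (temperOp υ P q θ)^[N] f x ≤ m + (1 - υ * ∫ z, q z / Q ∂θ) ^ N * (2 * C) by
    obtain ⟨h1, h2, h3, m, hm⟩ := h
    refine ⟨h1, h2, fun x => ?_⟩
    have hi : Integrable ((temperOp υ P q θ)^[N] f) ρ := integrable_of_bounded h1.measurable h2
    have e1 := integral_mono (integrable_const m) hi fun x => (hm x).1
    have e2 := integral_mono hi (integrable_const _) fun x => (hm x).2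
    rw [h3] at e1 e2
    simp only [integral_const, probReal_univ, one_smul] at e1 e2
    have := hm x
    rw [abs_le]; constructor <;> linarith
  induction N with
  | zero =>
    refine ⟨hf, hC, rfl, -C, fun x => ?_⟩
    have := abs_le.1 (hC x)
    simp only [Function.iterate_zero, id, pow_zero]
    constructor <;> linarith
  | succ N ih =>
    obtain ⟨h1, h2, h3, m, hm⟩ := ih
    simp_rw [Function.iterate_succ_apply']
    refine ⟨continuous_temperOp hFeller hq hq0 h1 h2,
      abs_temperOp_le hυ hq.measurable hq0 h1.measurable h2,
      (integral_temperOp hP hq hq0 hθ hqi h1 h2).trans h3, ?_⟩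
    obtain ⟨m', hm'⟩ := temperOp_contracts (P := P) (θ := θ) hυ hq.measurable hq0 hqQ
      h1.measurable (fun x => (hm x).1) (fun x => (hm x).2)
    exact ⟨m', fun x => ⟨(hm' x).1, (hm' x).2.trans (le_of_eq (by ring))⟩⟩

end Limit

/-! ### Tempered probability measures -/

section Tempered

variable {S : Type*} [MeasurableSpace S] {μ : Measure S} {p : S → ℝ} {a b s : ℝ}

/-- The probability measure with density proportional to `p ^ a`. -/
def temperedMeasure (μ : Measure S) (p : S → ℝ) (a : ℝ) : Measure S :=
  (powMeasure μ p a Set.univ)⁻¹ • powMeasure μ p a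

lemma powMeasure_univ : powMeasure μ p a Set.univ = ∫⁻ x, ENNReal.ofReal (p x ^ a) ∂μ := by
  rw [powMeasure, withDensity_apply _ MeasurableSet.univ, setLIntegral_univ]

lemma invariant_temperedMeasure {P : Kernel S S} (hP : Kernel.Invariant P (powMeasure μ p a)) :
    Kernel.Invariant P (temperedMeasure μ p a) := by
  rw [Kernel.Invariant, temperedMeasure, Measure.bind_smul, hP.def]

/-- The means by which an upper bound on `p` allows exponents to be lowered; it is also used with
negative exponents. -/
lemma rpow_le_mul_rpow {M y : ℝ} (hy : 0 < y) (hyM : y ≤ M) (hab : a ≤ b) :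
    y ^ b ≤ M ^ (b - a) * y ^ a := by
  rw [show b = (b - a) + a by ring, Real.rpow_add hy, add_sub_cancel_right]
  gcongr

variable [TopologicalSpace S]

namespace IsTargetDensity

variable (hp : IsTargetDensity μ p)
include hp

lemma exists_le : ∃ M, 0 < M ∧ ∀ x, p x ≤ M := by
  obtain ⟨M, hM⟩ := hp.bddAbove
  exact ⟨max M 1, by positivity, fun x => (hM ⟨x, rfl⟩).trans (le_max_left _ _)⟩

lemma continuous_rpow (a : ℝ) : Continuous fun x => p x ^ a :=
  hp.continuous.rpow_const fun x => Or.inl (hp.pos x).ne'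

lemma powMeasure_univ_lt_top (hab : a ≤ b) (ha : powMeasure μ p a Set.univ < ∞) :
    powMeasure μ p b Set.univ < ∞ := by
  obtain ⟨M, hM, hpM⟩ := hp.exists_le
  rw [powMeasure_univ] at *
  refine lt_of_le_of_lt (lintegral_mono (g := fun x => ENNReal.ofReal (M ^ (b - a)) *
    ENNReal.ofReal (p x ^ a)) fun x => ?_) ?_
  · simp only
    rw [← ENNReal.ofReal_mul (Real.rpow_nonneg hM.le _)]
    exact ENNReal.ofReal_le_ofReal (rpow_le_mul_rpow (hp.pos x) (hpM x) hab)
  · rw [lintegral_const_mul' _ _ ENNReal.ofReal_ne_top]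
    exact ENNReal.mul_lt_top ENNReal.ofReal_lt_top ha

variable [BorelSpace S]

lemma measurable : Measurable p := hp.continuous.measurable

lemma powMeasure_univ_ne_zero : powMeasure μ p a Set.univ ≠ 0 := by
  rw [powMeasure_univ]
  intro h
  rw [lintegral_eq_zero_iff (hp.measurable.pow_const a).ennreal_ofReal] at h
  have h0 : ∀ᵐ x ∂μ, False := by
    filter_upwards [h] with x hx
    have := ENNReal.ofReal_eq_zero.1 hx
    exact absurd (Real.rpow_pos_of_pos (hp.pos x) a) (not_lt.2 this)
  have hμ : μ = 0 := by
    rw [← Measure.measure_univ_eq_zero]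
    simpa [ae_iff] using h0
  have := hp.lintegral_eq_one
  simp [hμ] at this

lemma isProbabilityMeasure_temperedMeasure (ha : powMeasure μ p a Set.univ < ∞) :
    IsProbabilityMeasure (temperedMeasure μ p a) :=
  ⟨by rw [temperedMeasure, Measure.smul_apply, smul_eq_mul,
    ENNReal.inv_mul_cancel hp.powMeasure_univ_ne_zero ha.ne]⟩

lemma integral_powMeasure (f : S → ℝ) :
    ∫ x, f x ∂(powMeasure μ p a) = ∫ x, p x ^ a * f x ∂μ := by
  rw [powMeasure, integral_withDensity_eq_integral_toReal_smul
    (hp.measurable.pow_const a).ennreal_ofReal (by simp)]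
  simp_rw [ENNReal.toReal_ofReal (Real.rpow_nonneg (hp.pos _).le a), smul_eq_mul]

lemma integral_temperedMeasure (f : S → ℝ) :
    ∫ x, f x ∂(temperedMeasure μ p a) =
      (powMeasure μ p a Set.univ).toReal⁻¹ * ∫ x, p x ^ a * f x ∂μ := by
  rw [temperedMeasure, integral_smul_measure, hp.integral_powMeasure, ENNReal.toReal_inv,
    smul_eq_mul]

lemma integral_rpow : ∫ x, p x ^ a ∂μ = (powMeasure μ p a Set.univ).toReal := by
  rw [powMeasure_univ, integral_eq_lintegral_of_nonneg_ae
    (Eventually.of_forall fun x => Real.rpow_nonneg (hp.pos x).le a)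
    (hp.measurable.pow_const a).aestronglyMeasurable]

lemma integral_temperedMeasure_eq_integral_mul_div (f : S → ℝ) :
    ∫ x, f x ∂(temperedMeasure μ p a) = ∫ x, f x * (p x ^ a / ∫ y, p y ^ a ∂μ) ∂μ := by
  rw [hp.integral_temperedMeasure, hp.integral_rpow, ← integral_const_mul]
  congr 1; ext x; ring

/-- Both sides integrate `p ^ b * f` against `μ`, so no integrability of `f` is required. With `q =
p ^ (a - b)` this is the density relation `hθ` of `integral_temperOp`. -/
lemma integral_temperedMeasure_change (ha : powMeasure μ p a Set.univ < ∞) (f : S → ℝ) :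
    ∫ x, f x ∂(temperedMeasure μ p b) =
      ((powMeasure μ p a Set.univ).toReal / (powMeasure μ p b Set.univ).toReal) *
        ∫ x, (p x ^ (a - b))⁻¹ * f x ∂(temperedMeasure μ p a) := by
  have h0 : (powMeasure μ p a Set.univ).toReal ≠ 0 :=
    ENNReal.toReal_ne_zero.2 ⟨hp.powMeasure_univ_ne_zero, ha.ne⟩
  have : ∀ x, p x ^ a * ((p x ^ (a - b))⁻¹ * f x) = p x ^ b * f x := fun x => by
    rw [← Real.rpow_neg (hp.pos x).le, ← mul_assoc, ← Real.rpow_add (hp.pos x)]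
    ring_nf
  rw [hp.integral_temperedMeasure, hp.integral_temperedMeasure]
  simp_rw [this]
  field_simp

lemma integrable_rpow_neg_temperedMeasure (h : powMeasure μ p (a - s) Set.univ < ∞) :
    Integrable (fun x => p x ^ (-s)) (temperedMeasure μ p a) := by
  refine Integrable.smul_measure ?_ (ENNReal.inv_ne_top.2 hp.powMeasure_univ_ne_zero)
  refine ⟨(hp.measurable.pow_const _).aestronglyMeasurable, ?_⟩
  rw [hasFiniteIntegral_iff_ofReal (Eventually.of_forall fun x =>
    Real.rpow_nonneg (hp.pos x).le _), powMeasure, lintegral_withDensity_eq_lintegral_mul _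
    (hp.measurable.pow_const a).ennreal_ofReal (hp.measurable.pow_const _).ennreal_ofReal]
  rw [powMeasure_univ] at h
  refine lt_of_le_of_lt (le_of_eq (lintegral_congr fun x => ?_)) h
  rw [Pi.mul_apply, ← ENNReal.ofReal_mul (Real.rpow_nonneg (hp.pos x).le _),
    ← Real.rpow_add (hp.pos x), sub_eq_add_neg]

end IsTargetDensity

end Tempered

/-! ### One level of interacting tempering -/

section Level

variable {S Ω : Type*} [MeasurableSpace S] {mΩ : MeasurableSpace Ω} {ν : Measure Ω}
  {ℱ : Filtration ℕ mΩ} {υ : ℝ} {P : Kernel S S} {q : S → ℝ} {X Y : ℕ → Ω → S}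

/-- Given the past, `X (n + 1)` is drawn from the interacting tempering step based on the empirical
measure of `Y`. -/
def HasTemperStep (ν : Measure Ω) (ℱ : Filtration ℕ mΩ) (υ : ℝ) (P : Kernel S S) (q : S → ℝ)
    (X Y : ℕ → Ω → S) : Prop :=
  ∀ (n : ℕ) (f : S → ℝ), Measurable f → (∃ C : ℝ, ∀ x, |f x| ≤ C) →
    ν[fun ω => f (X (n + 1) ω) | ℱ n] =ᵐ[ν]
      fun ω => temperOp υ P q (empiricalMeasure Y n ω) f (X n ω)

/-- The step property only covers bounded test functions, hence the truncation on the left; the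
right side is free of `R`, so the bound is uniform in it. -/
lemma condExp_min_le [IsMarkovKernel P] (hυ : υ ∈ Set.Ioo (0 : ℝ) 1) (hq : Measurable q)
    (hq0 : ∀ x, 0 < q x) (hstep : HasTemperStep ν ℱ υ P q X Y) {W : S → ℝ}
    (hW : Measurable W) (hW0 : ∀ x, 0 ≤ W x) {l : ℝ} (hl : 0 ≤ l) {b : ℝ≥0}
    (hd : ∀ x, ∫⁻ y, ENNReal.ofReal (W y) ∂(P x) ≤ ENNReal.ofReal (l * W x) + b) (n R : ℕ) :
    ν[fun ω => min (W (X (n + 1) ω)) R | ℱ n] ≤ᵐ[ν] fun ω =>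
      ((1 - υ) * l + υ) * W (X n ω) +
        ((1 - υ) * b + υ * runningAvg (fun k => W (Y k ω)) (n + 1)) := by
  have hm : Measurable fun y => min (W y) (R : ℝ) := hW.min measurable_const
  have hmR : ∀ y, |min (W y) (R : ℝ)| ≤ R := fun y => by
    rw [abs_of_nonneg (le_min (hW0 y) (Nat.cast_nonneg R))]; exact min_le_right _ _
  filter_upwards [hstep n _ hm ⟨R, hmR⟩] with ω hω
  rw [hω]
  refine (temperOp_min_le hυ hq hq0 hW hW0 hl hd (Nat.cast_nonneg R) (X n ω)).trans ?_
  rw [integral_empiricalMeasure _ _ _ hm]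
  have := mul_le_mul_of_nonneg_left
    (runningAvg_mono (fun k => min_le_left (W (Y k ω)) (R : ℝ)) (n + 1)) hυ.1.le
  linarith

/-- One-step moment inequality. -/
lemma lintegral_succ_le [IsProbabilityMeasure ν] [IsMarkovKernel P]
    (hυ : υ ∈ Set.Ioo (0 : ℝ) 1) (hq : Measurable q)
    (hq0 : ∀ x, 0 < q x) (hX : ∀ n, Measurable (X n)) (hY : ∀ n, Measurable (Y n))
    (hstep : HasTemperStep ν ℱ υ P q X Y) {W : S → ℝ}
    (hW : Measurable W) (hW0 : ∀ x, 0 ≤ W x) {l : ℝ} (hl : 0 ≤ l) {b C : ℝ≥0}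
    (hd : ∀ x, ∫⁻ y, ENNReal.ofReal (W y) ∂(P x) ≤ ENNReal.ofReal (l * W x) + b)
    (hYC : ∀ n, ∫⁻ ω, ENNReal.ofReal (W (Y n ω)) ∂ν ≤ C) (n : ℕ) :
    ∫⁻ ω, ENNReal.ofReal (W (X (n + 1) ω)) ∂ν ≤
      ENNReal.ofReal ((1 - υ) * l + υ) * ∫⁻ ω, ENNReal.ofReal (W (X n ω)) ∂ν + (b + C) := by
  have hυ1 : 0 ≤ 1 - υ := by linarith [hυ.2]
  have hl' : 0 ≤ (1 - υ) * l + υ := add_nonneg (mul_nonneg hυ1 hl) hυ.1.le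
  have hWX : ∀ k, Measurable fun ω => W (X k ω) := fun k => hW.comp (hX k)
  have hWY : ∀ k, Measurable fun ω => W (Y k ω) := fun k => hW.comp (hY k)
  have hpt : ∀ ω, ENNReal.ofReal (((1 - υ) * l + υ) * W (X n ω) +
      ((1 - υ) * b + υ * runningAvg (fun k => W (Y k ω)) (n + 1))) ≤
      ENNReal.ofReal ((1 - υ) * l + υ) * ENNReal.ofReal (W (X n ω)) +
        (b + ((n + 1 : ℕ) : ℝ≥0∞)⁻¹ *
          ∑ k ∈ Finset.range (n + 1), ENNReal.ofReal (W (Y k ω))) := fun ω => by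
    have hs0 : 0 ≤ ∑ k ∈ Finset.range (n + 1), W (Y k ω) := Finset.sum_nonneg fun k _ => hW0 _
    have hr0 : 0 ≤ runningAvg (fun k => W (Y k ω)) (n + 1) := by unfold runningAvg; positivity
    rw [← ENNReal.ofReal_mul hl']
    refine ENNReal.ofReal_add_le.trans (add_le_add le_rfl (ENNReal.ofReal_add_le.trans
      (add_le_add ?_ ?_)))
    · rw [← ENNReal.ofReal_coe_nnreal]
      exact ENNReal.ofReal_le_ofReal (mul_le_of_le_one_left b.coe_nonneg (by linarith [hυ.1]))
    · refine (ENNReal.ofReal_le_ofReal (mul_le_of_le_one_left hr0 hυ.2.le)).trans (le_of_eq ?_)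
      rw [runningAvg, ENNReal.ofReal_mul (by positivity),
        ENNReal.ofReal_sum_of_nonneg fun k _ => hW0 _, ENNReal.ofReal_inv_of_pos (by positivity),
        ENNReal.ofReal_natCast]
  have hR : ∀ R : ℕ, ∫⁻ ω, ENNReal.ofReal (min (W (X (n + 1) ω)) R) ∂ν ≤
      ENNReal.ofReal ((1 - υ) * l + υ) * ∫⁻ ω, ENNReal.ofReal (W (X n ω)) ∂ν + (b + C) := by
    intro R
    have hm0 : ∀ ω, 0 ≤ min (W (X (n + 1) ω)) (R : ℝ) := fun ω =>
      le_min (hW0 _) (Nat.cast_nonneg R)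
    have hmi : Integrable (fun ω => min (W (X (n + 1) ω)) (R : ℝ)) ν :=
      integrable_of_bounded (C := R) ((hWX (n + 1)).min measurable_const) fun ω => by
        rw [abs_of_nonneg (hm0 ω)]; exact min_le_right _ _
    rw [← ofReal_integral_eq_lintegral_ofReal hmi (Eventually.of_forall hm0),
      ← integral_condExp (ℱ.le n), ofReal_integral_eq_lintegral_ofReal integrable_condExp
        (condExp_nonneg (Eventually.of_forall hm0))]
    have hle := condExp_min_le hυ hq hq0 hstep hW hW0 hl hd n R
    refine (lintegral_mono_ae (g := fun ω => ENNReal.ofReal ((1 - υ) * l + υ) *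
        ENNReal.ofReal (W (X n ω)) + (b + ((n + 1 : ℕ) : ℝ≥0∞)⁻¹ *
          ∑ k ∈ Finset.range (n + 1), ENNReal.ofReal (W (Y k ω)))) ?_).trans ?_
    · filter_upwards [hle] with ω hω
      exact (ENNReal.ofReal_le_ofReal hω).trans (hpt ω)
    · rw [lintegral_add_left ((hWX n).ennreal_ofReal.const_mul _),
        lintegral_const_mul _ (hWX n).ennreal_ofReal, lintegral_add_left measurable_const,
        lintegral_const, measure_univ, mul_one,
        lintegral_const_mul _ (Finset.measurable_sum _ fun k _ => (hWY k).ennreal_ofReal),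
        lintegral_finsetSum _ fun k _ => (hWY k).ennreal_ofReal]
      gcongr
      have h1 := Finset.sum_le_card_nsmul (Finset.range (n + 1))
        (fun k => ∫⁻ ω, ENNReal.ofReal (W (Y k ω)) ∂ν) C fun k _ => hYC k
      rw [Finset.card_range, nsmul_eq_mul] at h1
      refine (mul_le_mul_right h1 _).trans (le_of_eq ?_)
      rw [← mul_assoc, ENNReal.inv_mul_cancel (by simp) (ENNReal.natCast_ne_top _), one_mul]
  -- The truncation is removed by monotone convergence.
  have hlim : Tendsto (fun R : ℕ => ∫⁻ ω, ENNReal.ofReal (min (W (X (n + 1) ω)) R) ∂ν) atTop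
      (𝓝 (∫⁻ ω, ENNReal.ofReal (W (X (n + 1) ω)) ∂ν)) := by
    refine lintegral_tendsto_of_tendsto_of_monotone
      (fun R => ((hWX (n + 1)).min measurable_const).ennreal_ofReal.aemeasurable)
      (Eventually.of_forall fun ω R R' hRR => ENNReal.ofReal_le_ofReal
        (min_le_min le_rfl (Nat.cast_le.2 hRR))) (Eventually.of_forall fun ω => ?_)
    obtain ⟨N, hN⟩ := exists_nat_ge (W (X (n + 1) ω))
    refine tendsto_const_nhds.congr' ?_
    filter_upwards [eventually_ge_atTop N] with R hRN
    rw [min_eq_left (hN.trans (Nat.cast_le.2 hRN))]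
  exact le_of_tendsto' hlim hR

/-- Moments of the chain stay bounded if those of the chain it interacts with do. -/
lemma exists_lintegral_le [IsProbabilityMeasure ν] [IsMarkovKernel P]
    (hυ : υ ∈ Set.Ioo (0 : ℝ) 1) (hq : Measurable q)
    (hq0 : ∀ x, 0 < q x) (hX : ∀ n, Measurable (X n)) (hY : ∀ n, Measurable (Y n))
    (hstep : HasTemperStep ν ℱ υ P q X Y) {W : S → ℝ}
    (hW : Measurable W) (hW0 : ∀ x, 0 ≤ W x) (hdrift : HasDrift P W)
    (hYC : ∃ C : ℝ≥0, ∀ n, ∫⁻ ω, ENNReal.ofReal (W (Y n ω)) ∂ν ≤ C)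
    (hX0 : ∫⁻ ω, ENNReal.ofReal (W (X 0 ω)) ∂ν < ∞) :
    ∃ C : ℝ≥0, ∀ n, ∫⁻ ω, ENNReal.ofReal (W (X n ω)) ∂ν ≤ C := by
  obtain ⟨l, ⟨hl0, hl1⟩, b, hd⟩ := hdrift
  obtain ⟨C, hC⟩ := hYC
  have hυ0 := hυ.1
  have hυ1 := hυ.2
  have hL0 : 0 ≤ (1 - υ) * l + υ := by nlinarith
  have hL1 : (1 - υ) * l + υ < 1 := by nlinarith
  set L : ℝ := (1 - υ) * l + υ with hL
  set A : ℝ := (∫⁻ ω, ENNReal.ofReal (W (X 0 ω)) ∂ν).toReal with hA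
  have hA0 : 0 ≤ A := ENNReal.toReal_nonneg
  have h1L : 0 < 1 - L := by linarith
  -- Chosen to dominate the initial moment and to satisfy `L * D + (b + C) ≤ D`.
  set D : ℝ := A + (b + C) / (1 - L) with hD
  have hbC : (0 : ℝ) ≤ b + C := by positivity
  have hD0 : 0 ≤ D := by positivity
  refine ⟨D.toNNReal, fun n => ?_⟩
  change _ ≤ ENNReal.ofReal D
  induction n with
  | zero =>
    rw [← ENNReal.ofReal_toReal hX0.ne]
    refine ENNReal.ofReal_le_ofReal ?_
    have : 0 ≤ (b + C : ℝ) / (1 - L) := by positivity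
    rw [hD]; linarith
  | succ n ih =>
    refine (lintegral_succ_le hυ hq hq0 hX hY hstep hW hW0 hl0.le hd hC n).trans ?_
    rw [← hL]
    refine (add_le_add (mul_le_mul_right ih _) le_rfl).trans ?_
    rw [← ENNReal.ofReal_mul hL0, ← ENNReal.ofReal_coe_nnreal, ← ENNReal.ofReal_coe_nnreal,
      ← ENNReal.ofReal_add b.coe_nonneg C.coe_nonneg,
      ← ENNReal.ofReal_add (mul_nonneg hL0 hD0) hbC]
    refine ENNReal.ofReal_le_ofReal ?_
    have : (1 - L) * ((b + C : ℝ) / (1 - L)) = b + C := mul_div_cancel₀ _ h1L.ne'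
    rw [hD]
    nlinarith

variable [TopologicalSpace S] [BorelSpace S]

/-- Uniform convergence of acceptance averages against the empirical measures. -/
lemma ae_eventually_abs_swapAvg_sub_le {θ : Measure S} [IsProbabilityMeasure θ]
    (hq : Continuous q) (hq0 : ∀ x, 0 < q x) {Q : ℝ} (hQ : 0 < Q)
    (hSLLN : ∀ f : S → ℝ, Continuous f → (∃ C : ℝ, ∀ x, |f x| ≤ C) →
      ∀ᵐ ω ∂ν, Tendsto (runningAvg fun k => f (Y k ω)) atTop (𝓝 (∫ x, f x ∂θ)))
    {f : S → ℝ} (hf : Continuous f) {C : ℝ} (hC : ∀ x, |f x| ≤ C) :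
    ∀ᵐ ω ∂ν, ∀ ε > 0, ∀ᶠ n in atTop, ∀ t ∈ Set.Icc 0 Q,
      |swapAvg q (empiricalMeasure Y n ω) f t - swapAvg q θ f t| ≤ ε := by
  have hnonneg : ∀ g : S → ℝ, Continuous g → (∀ x, 0 ≤ g x) → (∃ C : ℝ, ∀ x, |g x| ≤ C) →
      ∀ᵐ ω ∂ν, ∀ ε > 0, ∀ᶠ n in atTop, ∀ t ∈ Set.Icc 0 Q,
        |swapAvg q (empiricalMeasure Y n ω) g t - swapAvg q θ g t| ≤ ε := by
    rintro g hg hg0 ⟨D, hD⟩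
    have hc : ∀ t : ℝ, Continuous fun z => q z / max (q z) t * g z := fun t =>
      (hq.div (hq.max continuous_const)
        fun z => (lt_of_lt_of_le (hq0 z) (le_max_left _ _)).ne').mul hg
    have hb : ∀ t : ℝ, ∃ C : ℝ, ∀ z, |q z / max (q z) t * g z| ≤ C := fun t => ⟨D, fun z => by
      rw [abs_mul, abs_of_nonneg (div_max_mem_Icc (hq0 z) t).1]
      exact (mul_le_of_le_one_left (abs_nonneg _) (div_max_mem_Icc (hq0 z) t).2).trans (hD z)⟩
    -- Only countably many values of `t` are used, so one null set suffices.
    have hgrid : ∀ᵐ ω ∂ν, ∀ m k : ℕ, Tendsto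
        (fun n => swapAvg q (empiricalMeasure Y n ω) g (Q * ((k : ℝ) / m))) atTop
        (𝓝 (swapAvg q θ g (Q * ((k : ℝ) / m)))) := by
      rw [ae_all_iff]; intro m
      rw [ae_all_iff]; intro k
      filter_upwards [hSLLN _ (hc (Q * ((k : ℝ) / m))) (hb _)] with ω hω
      have := (tendsto_add_atTop_iff_nat 1).2 hω
      refine this.congr fun n => ?_
      rw [swapAvg, integral_empiricalMeasure _ _ _ (hc _).measurable]
    filter_upwards [hgrid] with ω hω ε hε
    exact eventually_forall_abs_sub_le_of_antitone hQ
      (fun n => antitone_swapAvg hq.measurable hq0 (integrable_of_bounded hg.measurable hD) hg0)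
      (continuous_swapAvg hq.measurable hq0 (integrable_of_bounded hg.measurable hD)) hω hε
  -- Pólya's theorem needs a nonnegative integrand: it is applied to `f + C` and to `1`, and `f` is
  -- recovered by linearity.
  have hC1 : ∀ x, 0 ≤ f x + C := fun x => by linarith [(abs_le.1 (hC x)).1]
  filter_upwards [hnonneg (fun x => f x + C) (hf.add continuous_const) hC1 ⟨2 * C, fun x => by
      rw [abs_of_nonneg (hC1 x)]; linarith [(abs_le.1 (hC x)).2]⟩,
    hnonneg (fun _ => 1) continuous_const (fun _ => zero_le_one) ⟨1, by simp⟩] with ω h1 h2 ε hε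
  have hε2 : 0 < ε / (2 * (|C| + 1)) := by positivity
  filter_upwards [h1 (ε / 2) (by positivity), h2 _ hε2] with n h1 h2 t ht
  have e1 := h1 t ht
  have e2 := h2 t ht
  rw [swapAvg_add_const hq.measurable hq0 (integrable_of_bounded hf.measurable hC),
    swapAvg_add_const hq.measurable hq0 (integrable_of_bounded hf.measurable hC)] at e1
  set a := swapAvg q (empiricalMeasure Y n ω) (fun _ => 1) t
  set a' := swapAvg q θ (fun _ => 1) t
  have e3 : |C * (a - a')| ≤ ε / 2 := by
    rw [abs_mul]
    calc |C| * |a - a'| ≤ (|C| + 1) * (ε / (2 * (|C| + 1))) := by gcongr; linarith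
      _ = ε / 2 := by field_simp
  rw [abs_le] at *
  constructor <;> linarith

/-- The averages of `f - P_* f` along the chain vanish, where `P_*` is the limiting operator. -/
lemma ae_tendsto_runningAvg_sub_temperOp [IsProbabilityMeasure ν] [IsMarkovKernel P]
    (hυ : υ ∈ Set.Ioo (0 : ℝ) 1) {θ : Measure S}
    [IsProbabilityMeasure θ] (hq : Continuous q) (hq0 : ∀ x, 0 < q x) {Q : ℝ} (hQ : 0 < Q)
    (hqQ : ∀ x, q x ≤ Q) (hX : ∀ n, Measurable[ℱ n] (X n))
    (hstep : HasTemperStep ν ℱ υ P q X Y)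
    (hSLLN : ∀ f : S → ℝ, Continuous f → (∃ C : ℝ, ∀ x, |f x| ≤ C) →
      ∀ᵐ ω ∂ν, Tendsto (runningAvg fun k => f (Y k ω)) atTop (𝓝 (∫ x, f x ∂θ)))
    {f : S → ℝ} (hf : Continuous f) {C : ℝ} (hC : ∀ x, |f x| ≤ C) :
    ∀ᵐ ω ∂ν, Tendsto (runningAvg fun k => f (X k ω) - temperOp υ P q θ f (X k ω)) atTop (𝓝 0) := by
  have hmart := ae_tendsto_compensatedSum_div (ν := ν) (ℱ := ℱ) (Y := fun n ω => f (X n ω)) (C := C)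
    (fun n => (hf.measurable.comp (hX n)).stronglyMeasurable) fun n ω => hC _
  have hcond : ∀ᵐ ω ∂ν, ∀ n, (ν[fun ω => f (X (n + 1) ω) | ℱ n]) ω =
      temperOp υ P q (empiricalMeasure Y n ω) f (X n ω) :=
    ae_all_iff.2 fun n => hstep n f hf.measurable ⟨C, hC⟩
  filter_upwards [hmart, hcond, ae_eventually_abs_swapAvg_sub_le hq hq0 hQ hSLLN hf hC,
    ae_eventually_abs_swapAvg_sub_le hq hq0 hQ hSLLN (f := fun _ => 1) continuous_const (C := 1)
      (by simp)] with ω hm hc hu hu1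
  -- Convergence is uniform over `t ∈ [0, Q]`, which contains every `q (X n ω)`, so the position of
  -- the chain is irrelevant.
  have hdiff : Tendsto (fun n => temperOp υ P q (empiricalMeasure Y n ω) f (X n ω) -
      temperOp υ P q θ f (X n ω)) atTop (𝓝 0) := by
    rw [Metric.tendsto_atTop']
    intro ε hε
    have hε2 : 0 < ε / (4 * (|C| + 1)) := by positivity
    obtain ⟨N, hN⟩ := eventually_atTop.1 ((hu (ε / 4) (by positivity)).and (hu1 _ hε2))
    refine ⟨N, fun n hn => ?_⟩
    obtain ⟨e1, e2⟩ := hN n hn.le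
    have hqx : q (X n ω) ∈ Set.Icc 0 Q := ⟨(hq0 _).le, hqQ _⟩
    specialize e1 _ hqx
    specialize e2 _ hqx
    rw [Real.dist_eq, sub_zero, temperOp_sub_eq]
    set d := swapAvg q (empiricalMeasure Y n ω) f (q (X n ω)) - swapAvg q θ f (q (X n ω))
    set d1 := swapAvg q (empiricalMeasure Y n ω) (fun _ => 1) (q (X n ω)) -
      swapAvg q θ (fun _ => 1) (q (X n ω))
    have e3 : |d1 * f (X n ω)| ≤ ε / 4 := by
      rw [abs_mul]
      calc |d1| * |f (X n ω)| ≤ (ε / (4 * (|C| + 1))) * (|C| + 1) := by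
            gcongr
            exact ((hC _).trans (le_abs_self C)).trans (by linarith)
        _ = ε / 4 := by field_simp
    rw [abs_mul, abs_of_pos hυ.1]
    have e4 : |d - d1 * f (X n ω)| ≤ ε / 2 := by
      rw [abs_le] at *
      constructor <;> linarith
    have := mul_le_of_le_one_left (abs_nonneg (d - d1 * f (X n ω))) hυ.2.le
    linarith
  have hend : Tendsto (fun n : ℕ => (n : ℝ)⁻¹ * (f (X n ω) - f (X 0 ω))) atTop (𝓝 0) := by
    have h1 : Tendsto (fun n : ℕ => 2 * C * (1 / (n : ℝ))) atTop (𝓝 (2 * C * 0)) :=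
      tendsto_const_nhds.mul tendsto_one_div_atTop_nhds_zero_nat
    rw [mul_zero] at h1
    refine squeeze_zero_norm (fun n => ?_) h1
    have h2 := abs_le.1 (hC (X n ω))
    have h3 := abs_le.1 (hC (X 0 ω))
    have h4 : |f (X n ω) - f (X 0 ω)| ≤ 2 * C := by rw [abs_le]; constructor <;> linarith
    rw [norm_mul, norm_inv, Real.norm_eq_abs, Real.norm_eq_abs, Nat.abs_cast, mul_comm, one_div]
    gcongr
  -- Each `f (X k) - A f (X k)`, with `A` the limiting operator, is a martingale increment, plus the
  -- operator error, minus the telescoping `f (X (k + 1)) - f (X k)`.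
  have hall := (hm.add hdiff.cesaro).sub hend
  rw [add_zero, sub_zero] at hall
  refine hall.congr fun n => ?_
  have htel : ∑ k ∈ Finset.range n, (f (X (k + 1) ω) - f (X k ω)) = f (X n ω) - f (X 0 ω) :=
    Finset.sum_range_sub (fun k => f (X k ω)) n
  rw [compensatedSum, ← htel, ← mul_add, ← mul_sub, ← Finset.sum_add_distrib,
    ← Finset.sum_sub_distrib, runningAvg]
  congr 1
  refine Finset.sum_congr rfl fun k _ => ?_
  rw [hc k]; ring

/-- Strong law of large numbers for bounded continuous functions. -/
lemma ae_tendsto_runningAvg_of_bounded [SecondCountableTopology S] [IsProbabilityMeasure ν]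
    [IsMarkovKernel P] (hυ : υ ∈ Set.Ioo (0 : ℝ) 1) {θ ρ : Measure S}
    [IsProbabilityMeasure θ] [IsProbabilityMeasure ρ] (hFeller : IsFeller P)
    (hP : Kernel.Invariant P ρ) (hq : Continuous q) (hq0 : ∀ x, 0 < q x) {Q : ℝ} (hQ : 0 < Q)
    (hqQ : ∀ x, q x ≤ Q) {c : ℝ}
    (hθ : ∀ h : S → ℝ, ∫ z, h z ∂θ = c * ∫ z, (q z)⁻¹ * h z ∂ρ)
    (hqi : Integrable (fun z => (q z)⁻¹) ρ) (hX : ∀ n, Measurable[ℱ n] (X n))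
    (hstep : HasTemperStep ν ℱ υ P q X Y)
    (hSLLN : ∀ f : S → ℝ, Continuous f → (∃ C : ℝ, ∀ x, |f x| ≤ C) →
      ∀ᵐ ω ∂ν, Tendsto (runningAvg fun k => f (Y k ω)) atTop (𝓝 (∫ x, f x ∂θ)))
    {f : S → ℝ} (hf : Continuous f) {C : ℝ} (hC : ∀ x, |f x| ≤ C) :
    ∀ᵐ ω ∂ν, Tendsto (runningAvg fun k => f (X k ω)) atTop (𝓝 (∫ x, f x ∂ρ)) := by
  set A := temperOp υ P q θ with hA
  have hiter := fun N => temperOp_iterate (P := P) (θ := θ) hυ hFeller hP hq hq0 hqQ hθ hqi hf hC N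
  set ε := υ * ∫ z, q z / Q ∂θ with hεdef
  have hwi : Integrable (fun z => q z / Q) θ :=
    integrable_of_bounded (C := 1) (hq.measurable.div_const Q) fun z => by
      rw [abs_of_nonneg (div_nonneg (hq0 z).le hQ.le)]; exact (div_le_one hQ).2 (hqQ z)
  have hpos : 0 < ∫ z, q z / Q ∂θ := by
    rw [integral_pos_iff_support_of_nonneg (fun z => (div_nonneg (hq0 z).le hQ.le)) hwi]
    have : Function.support (fun z => q z / Q) = Set.univ :=
      Set.eq_univ_of_forall fun z => (div_pos (hq0 z) hQ).ne'
    rw [this, measure_univ]; exact one_pos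
  have hle1 : ∫ z, q z / Q ∂θ ≤ 1 := by
    have := integral_mono hwi (integrable_const (1 : ℝ)) fun z => (div_le_one hQ).2 (hqQ z)
    simpa using this
  have hε0 : 0 < ε := mul_pos hυ.1 hpos
  have hε1 : ε ≤ 1 := mul_le_one₀ hυ.2.le hpos.le hle1
  have hsteps : ∀ᵐ ω ∂ν, ∀ N, Tendsto (runningAvg fun k => f (X k ω) - A^[N] f (X k ω)) atTop
      (𝓝 0) := by
    rw [ae_all_iff]
    intro N
    induction N with
    | zero =>
      refine Eventually.of_forall fun ω => ?_
      simpa using tendsto_runningAvg_const 0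
    | succ N ih =>
      filter_upwards [ih, ae_tendsto_runningAvg_sub_temperOp hυ hq hq0 hQ hqQ hX hstep hSLLN
        (hiter N).1 (hiter N).2.1] with ω h1 h2
      have := h1.add h2
      rw [add_zero] at this
      refine this.congr fun n => ?_
      rw [← runningAvg_add]
      congr 1; ext k
      rw [Function.iterate_succ_apply', hA]; ring
  filter_upwards [hsteps] with ω hω
  -- Replacing `A^N f` by the constant `∫ f dρ` costs at most `(1 - ε) ^ N * (2 * C)` uniformly
  -- along the path.
  refine tendsto_runningAvg_of_approx (w := fun _ => 1) (B := 1)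
    (b := fun N k => f (X k ω) - A^[N] f (X k ω) + ∫ x, f x ∂ρ) (l := fun _ => ∫ x, f x ∂ρ)
    (e := fun N => (1 - ε) ^ N * (2 * C)) (fun N => ?_) ?_ (fun N => ?_) tendsto_const_nhds
    (fun n => ?_) fun N k => ?_
  · have := (hω N).add (tendsto_runningAvg_const (∫ x, f x ∂ρ))
    rw [zero_add] at this
    exact this.congr fun n => (runningAvg_add _ _ n).symm
  · have := (tendsto_pow_atTop_nhds_zero_of_lt_one (r := 1 - ε) (by linarith) (by linarith)).mul_const
      (2 * C)
    rwa [zero_mul] at this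
  · have hC0 : 0 ≤ C := (abs_nonneg _).trans (hC (X 0 ω))
    exact mul_nonneg (pow_nonneg (by linarith) N) (by linarith)
  · rcases Nat.eq_zero_or_pos n with rfl | hn
    · simp [runningAvg]
    · rw [runningAvg_const_of_pos 1 hn]
  · rw [mul_one]
    have := (hiter N).2.2 (X k ω)
    refine le_trans (le_of_eq ?_) this
    congr 1; ring

end Level

/-! ### Weighted functions and their truncation -/

section Weight

variable {S : Type*} {p : S → ℝ}

lemma MemWeighted.exists_abs_le {f : S → ℝ} {s : ℝ} (hp : ∀ x, 0 < p x)
    (hf : MemWeighted (fun x => p x ^ (-s)) f) :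
    ∃ C, 0 < C ∧ ∀ x, |f x| ≤ C * p x ^ (-s) := by
  obtain ⟨C, hC⟩ := hf
  refine ⟨max C 1, by positivity, fun x => ?_⟩
  have h0 := Real.rpow_pos_of_pos (hp x) (-s)
  rw [← div_le_iff₀ h0]
  exact (hC ⟨x, rfl⟩).trans (le_max_left _ _)

lemma memWeighted_of_abs_le {f : S → ℝ} {s C : ℝ} (hp : ∀ x, 0 < p x)
    (hf : ∀ x, |f x| ≤ C * p x ^ (-s)) : MemWeighted (fun x => p x ^ (-s)) f := by
  refine ⟨C, ?_⟩
  rintro _ ⟨x, rfl⟩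
  exact (div_le_iff₀ (Real.rpow_pos_of_pos (hp x) (-s))).2 (hf x)

lemma MemWeighted.mono_exponent [TopologicalSpace S] [MeasurableSpace S] {μ : Measure S}
    (hp : IsTargetDensity μ p) {f : S → ℝ} {s t : ℝ} (hst : s ≤ t)
    (hf : MemWeighted (fun x => p x ^ (-s)) f) : MemWeighted (fun x => p x ^ (-t)) f := by
  obtain ⟨M, hM, hpM⟩ := hp.exists_le
  obtain ⟨C, hC0, hC⟩ := hf.exists_abs_le hp.pos
  refine memWeighted_of_abs_le (C := C * M ^ (-s - -t)) hp.pos fun x => (hC x).trans ?_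
  rw [mul_assoc]
  exact mul_le_mul_of_nonneg_left
    (rpow_le_mul_rpow (hp.pos x) (hpM x) (neg_le_neg hst)) hC0.le

/-- Truncation of a function dominated by `p ^ (-s)` costs little relative to `p ^ (-s')`. -/
lemma abs_sub_truncation_le (hp : ∀ x, 0 < p x) {f : S → ℝ} {s s' C η : ℝ} (hs : 0 ≤ s)
    (hss : s ≤ s') (hC : 0 ≤ C) (hf : ∀ x, |f x| ≤ C * p x ^ (-s)) (hη : 0 < η) (x : S) :
    |f x - max (-(C * η ^ (-s))) (min (f x) (C * η ^ (-s)))| ≤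
      C * η ^ (s' - s) * p x ^ (-s') := by
  have hR : 0 ≤ C * η ^ (-s) := by positivity
  have hW := Real.rpow_pos_of_pos (hp x) (-s')
  -- Where `p ≥ η` the bound on `f` is below the truncation level, so nothing is cut; where `p ≤ η`
  -- the surplus exponent gains the factor `η ^ (s' - s)`.
  rcases le_total (p x) η with h | h
  · have h1 : |f x - max (-(C * η ^ (-s))) (min (f x) (C * η ^ (-s)))| ≤ |f x| := by
      rcases le_total 0 (f x) with h0 | h0
      · have e1 : 0 ≤ min (f x) (C * η ^ (-s)) := le_min h0 hR
        rw [max_eq_right (by linarith), abs_of_nonneg (sub_nonneg.2 (min_le_left _ _)),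
          abs_of_nonneg h0]
        linarith
      · rw [min_eq_left (h0.trans hR), abs_of_nonpos (sub_nonpos.2 (le_max_right _ _)),
          abs_of_nonpos h0]
        have e1 : max (-(C * η ^ (-s))) (f x) ≤ 0 := max_le (by linarith) h0
        linarith
    refine h1.trans ((hf x).trans ?_)
    rw [mul_assoc]
    refine mul_le_mul_of_nonneg_left ?_ hC
    have := rpow_le_mul_rpow (hp x) h (neg_le_neg hss)
    rwa [show -s - -s' = s' - s by ring] at this
  · have h1 : |f x| ≤ C * η ^ (-s) := by
      refine (hf x).trans (mul_le_mul_of_nonneg_left ?_ hC)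
      exact Real.rpow_le_rpow_of_nonpos hη h (by linarith)
    rw [min_eq_left (abs_le.1 h1).2, max_eq_right (abs_le.1 h1).1, sub_self, abs_zero]
    positivity

end Weight

/-! ### Passing the weighted law of large numbers to the next lower temperature -/

section WeightedLLN

variable {S Ω : Type*} [TopologicalSpace S] [MeasurableSpace S] [BorelSpace S]
  {mΩ : MeasurableSpace Ω} {ν : Measure Ω} {μ : Measure S} {p : S → ℝ}

/-- `Y` satisfies the strong law of large numbers with limit the tempered measure of exponent `a`,
for all continuous functions dominated by `p ^ (-s)` for some `s ∈ [0, t)`. -/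
def HasSLLN (ν : Measure Ω) (μ : Measure S) (p : S → ℝ) (a t : ℝ) (Y : ℕ → Ω → S) : Prop :=
  ∀ s, 0 ≤ s → s < t → ∀ f : S → ℝ, Continuous f → MemWeighted (fun x => p x ^ (-s)) f →
    ∀ᵐ ω ∂ν, Tendsto (runningAvg fun k => f (Y k ω)) atTop
      (𝓝 (∫ x, f x ∂(temperedMeasure μ p a)))

variable [IsProbabilityMeasure ν] {ℱ : Filtration ℕ mΩ} {υ : ℝ}
  {P : Kernel S S} {X Y : ℕ → Ω → S} {a a' t : ℝ}

/-- Running averages of `p ^ (-s)` along the chain stay bounded. -/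
lemma ae_exists_runningAvg_rpow_le [IsMarkovKernel P] (hp : IsTargetDensity μ p)
    (hυ : υ ∈ Set.Ioo (0 : ℝ) 1) (hdrift : ∀ s ∈ Set.Ioo 0 a, HasDrift P fun x => p x ^ (-s))
    (hX : ∀ n, Measurable[ℱ n] (X n)) {q : S → ℝ} (hq : Measurable q) (hq0 : ∀ x, 0 < q x)
    (hstep : HasTemperStep ν ℱ υ P q X Y)
    (hmom : ∃ C : ℝ≥0, ∀ n, ∫⁻ ω, ENNReal.ofReal (p (X n ω) ^ (-t)) ∂ν ≤ C)
    (hY : HasSLLN ν μ p a' t Y) {s : ℝ} (hst : s < t) (hts : t ≤ 2 * s) (hsa : s < a) :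
    ∀ᵐ ω ∂ν, ∃ β, ∀ n, runningAvg (fun k => p (X k ω) ^ (-s)) n ≤ β := by
  have hs : 0 < s := by linarith
  obtain ⟨C, hC⟩ := hmom
  obtain ⟨l, ⟨hl0, hl1⟩, b, hd⟩ := hdrift s ⟨hs, hsa⟩
  have hWm : Measurable fun x => p x ^ (-s) := hp.measurable.pow_const _
  have hW0 : ∀ x, 0 ≤ p x ^ (-s) := fun x => Real.rpow_nonneg (hp.pos x).le _
  have hpow : ∀ x, (p x ^ (-s)) ^ (t / s) = p x ^ (-t) := fun x => by
    rw [← Real.rpow_mul (hp.pos x).le, neg_mul, mul_div_cancel₀ _ hs.ne']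
  have hXm : ∀ n, Measurable (X n) := fun n => (hX n).mono (ℱ.le n) le_rfl
  have hVm : ∀ n, Measurable fun ω => p (X n ω) ^ (-t) := fun n =>
    (hp.measurable.pow_const _).comp (hXm n)
  have hV0 : ∀ n ω, 0 ≤ p (X n ω) ^ (-t) := fun n ω => Real.rpow_nonneg (hp.pos _).le _
  have hVi : ∀ n, Integrable (fun ω => p (X n ω) ^ (-t)) ν := fun n => by
    refine ⟨(hVm n).aestronglyMeasurable, ?_⟩
    rw [hasFiniteIntegral_iff_ofReal (Eventually.of_forall (hV0 n))]
    exact (hC n).trans_lt ENNReal.coe_lt_top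
  have hυ0 := hυ.1
  have hυ1 := hυ.2
  -- The order `r = t / s` turns moments of `p ^ (-s)` into the bounded moments of `p ^ (-t)`; `s <
  -- t ≤ 2 s` puts `r` in `(1, 2]`.
  refine ae_exists_runningAvg_le_of_drift (ν := ν) (ℱ := ℱ) (Y := fun n ω => p (X n ω) ^ (-s))
    (r := t / s) (C := C) (l := (1 - υ) * l + υ)
    (B := fun n ω => (1 - υ) * b + υ * runningAvg (fun k => p (Y k ω) ^ (-s)) (n + 1))
    (fun n => (hWm.comp (hX n)).stronglyMeasurable) (fun n ω => hW0 _)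
    ((one_lt_div hs).2 hst) ((div_le_iff₀ hs).2 hts) (fun n => by simpa only [hpow] using hVi n)
    (fun n => ?_) (by nlinarith) (by nlinarith)
    (fun n R => condExp_min_le hυ hq hq0 hstep hWm hW0 hl0.le hd n R) ?_
  · simp only [hpow]
    rw [integral_eq_lintegral_of_nonneg_ae (Eventually.of_forall (hV0 n))
      (hVm n).aestronglyMeasurable]
    exact ENNReal.toReal_le_of_le_ofReal C.coe_nonneg
      (by rw [ENNReal.ofReal_coe_nnreal]; exact hC n)
  · have hmem : MemWeighted (fun x => p x ^ (-s)) fun x => p x ^ (-s) :=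
      memWeighted_of_abs_le (C := 1) hp.pos fun x => by rw [abs_of_nonneg (hW0 x), one_mul]
    filter_upwards [hY s hs.le hst _ (hp.continuous_rpow (-s)) hmem] with ω hω
    have h1 := (tendsto_add_atTop_iff_nat 1).2 hω
    -- The inner averages converge by the law for `Y`, so their Cesàro means converge and are
    -- bounded.
    have h2 : Tendsto (runningAvg fun n =>
        (1 - υ) * (b : ℝ) + υ * runningAvg (fun k => p (Y k ω) ^ (-s)) (n + 1)) atTop _ :=
      (tendsto_const_nhds.add (h1.const_mul υ)).cesaro
    obtain ⟨β, hβ⟩ := h2.bddAbove_range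
    exact ⟨β, fun n => hβ ⟨n, rfl⟩⟩

/-- The strong law of large numbers passes from one temperature to the next lower one. -/
theorem HasSLLN.of_hasTemperStep [SecondCountableTopology S] [IsMarkovKernel P]
    (hp : IsTargetDensity μ p) (hυ : υ ∈ Set.Ioo (0 : ℝ) 1) (haa : a' ≤ a) (hta : t < a') (ht : 0 < t)
    (hZ : powMeasure μ p (a' - t) Set.univ < ∞) (hFeller : IsFeller P)
    (hInv : Kernel.Invariant P (powMeasure μ p a))
    (hdrift : ∀ s ∈ Set.Ioo 0 a, HasDrift P fun x => p x ^ (-s))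
    (hX : ∀ n, Measurable[ℱ n] (X n))
    (hstep : HasTemperStep ν ℱ υ P (fun x => p x ^ (a - a')) X Y)
    (hmom : ∃ C : ℝ≥0, ∀ n, ∫⁻ ω, ENNReal.ofReal (p (X n ω) ^ (-t)) ∂ν ≤ C)
    (hY : HasSLLN ν μ p a' t Y) : HasSLLN ν μ p a t X := by
  obtain ⟨M, hM, hpM⟩ := hp.exists_le
  have hZa' : powMeasure μ p a' Set.univ < ∞ := hp.powMeasure_univ_lt_top (by linarith) hZ
  have hZa : powMeasure μ p a Set.univ < ∞ := hp.powMeasure_univ_lt_top (by linarith) hZ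
  have := hp.isProbabilityMeasure_temperedMeasure hZa'
  have := hp.isProbabilityMeasure_temperedMeasure hZa
  have hq : Continuous fun x => p x ^ (a - a') := hp.continuous_rpow _
  have hq0 : ∀ x, 0 < p x ^ (a - a') := fun x => Real.rpow_pos_of_pos (hp.pos x) _
  have hqQ : ∀ x, p x ^ (a - a') ≤ M ^ (a - a') := fun x =>
    Real.rpow_le_rpow (hp.pos x).le (hpM x) (by linarith)
  have hqi : Integrable (fun x => (p x ^ (a - a'))⁻¹) (temperedMeasure μ p a) := by
    simp_rw [← Real.rpow_neg (hp.pos _).le]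
    exact hp.integrable_rpow_neg_temperedMeasure (by simpa using hZa')
  have hbdd : ∀ f : S → ℝ, Continuous f → (∃ C : ℝ, ∀ x, |f x| ≤ C) →
      ∀ᵐ ω ∂ν, Tendsto (runningAvg fun k => f (X k ω)) atTop
        (𝓝 (∫ x, f x ∂(temperedMeasure μ p a))) := by
    rintro f hf ⟨C, hC⟩
    refine ae_tendsto_runningAvg_of_bounded hυ hFeller (invariant_temperedMeasure hInv) hq hq0
      (by positivity) hqQ (hp.integral_temperedMeasure_change hZa) hqi hX hstep ?_ hf hC
    rintro g hg ⟨D, hD⟩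
    exact hY 0 le_rfl ht g hg
      (memWeighted_of_abs_le (C := D) hp.pos fun x => by simpa using hD x)
  intro s hs hst f hf hfs
  obtain ⟨C, hC0, hC⟩ := hfs.exists_abs_le hp.pos
  -- The midpoint satisfies `t ≤ 2 s'` because `s ≥ 0`.
  obtain ⟨s', hss', hs't, hts'⟩ : ∃ s', s < s' ∧ s' < t ∧ t ≤ 2 * s' :=
    ⟨(s + t) / 2, by linarith, by linarith, by linarith⟩
  have hWi : Integrable (fun x => p x ^ (-s')) (temperedMeasure μ p a) :=
    hp.integrable_rpow_neg_temperedMeasure (hp.powMeasure_univ_lt_top (by linarith) hZ)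
  have hfi : Integrable f (temperedMeasure μ p a) := by
    have h1 : Integrable (fun x => p x ^ (-s)) (temperedMeasure μ p a) :=
      hp.integrable_rpow_neg_temperedMeasure (hp.powMeasure_univ_lt_top (by linarith) hZ)
    exact (h1.const_mul C).mono' hf.aestronglyMeasurable (Eventually.of_forall hC)
  set η : ℕ → ℝ := fun m => 1 / ((m : ℝ) + 1) with hη
  have hη0 : ∀ m, 0 < η m := fun m => by simp only [hη]; positivity
  set F : ℕ → S → ℝ := fun m x => max (-(C * η m ^ (-s))) (min (f x) (C * η m ^ (-s))) with hF
  have hFc : ∀ m, Continuous (F m) := fun m =>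
    continuous_const.max (hf.min continuous_const)
  have hFb : ∀ m x, |F m x| ≤ C * η m ^ (-s) := fun m x => by
    have h0 : 0 ≤ C * η m ^ (-s) := mul_nonneg hC0.le (Real.rpow_nonneg (hη0 m).le _)
    exact abs_le.2 ⟨le_max_left _ _, max_le (by linarith) (min_le_right _ _)⟩
  have hFf : ∀ m x, |f x - F m x| ≤ C * η m ^ (s' - s) * p x ^ (-s') := fun m x =>
    abs_sub_truncation_le hp.pos hs hss'.le hC0.le hC (hη0 m) x
  have he : Tendsto (fun m => C * η m ^ (s' - s)) atTop (𝓝 0) := by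
    have h1 : Tendsto η atTop (𝓝 0) := tendsto_one_div_add_atTop_nhds_zero_nat
    have h2 := (h1.rpow_const (p := s' - s) (Or.inr (by linarith))).const_mul C
    rwa [Real.zero_rpow (by linarith), mul_zero] at h2
  have hlim : Tendsto (fun m => ∫ x, F m x ∂(temperedMeasure μ p a)) atTop
      (𝓝 (∫ x, f x ∂(temperedMeasure μ p a))) := by
    rw [tendsto_iff_norm_sub_tendsto_zero]
    have h1 := he.mul_const (∫ x, p x ^ (-s') ∂(temperedMeasure μ p a))
    rw [zero_mul] at h1
    refine squeeze_zero (fun m => norm_nonneg _) (fun m => ?_) h1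
    rw [← integral_sub (integrable_of_bounded (hFc m).measurable (hFb m)) hfi,
      ← integral_const_mul]
    refine norm_integral_le_of_norm_le (hWi.const_mul _) (Eventually.of_forall fun x => ?_)
    rw [Real.norm_eq_abs, abs_sub_comm]
    exact hFf m x
  have hall : ∀ᵐ ω ∂ν, ∀ m, Tendsto (runningAvg fun k => F m (X k ω)) atTop
      (𝓝 (∫ x, F m x ∂(temperedMeasure μ p a))) :=
    ae_all_iff.2 fun m => hbdd (F m) (hFc m) ⟨_, hFb m⟩
  filter_upwards [hall, ae_exists_runningAvg_rpow_le hp hυ hdrift hX hq.measurable hq0 hstep hmom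
    hY hs't hts' (by linarith)] with ω hω ⟨β, hβ⟩
  exact tendsto_runningAvg_of_approx hω he
    (fun m => mul_nonneg hC0.le (Real.rpow_nonneg (hη0 m).le _)) hlim hβ fun m k => hFf m (X k ω)

end WeightedLLN

end InteractingTempering

end

/-! ### Descending induction over the temperatures -/

theorem theorem3p6 {S : Type*} [TopologicalSpace S] [PolishSpace S] [MeasurableSpace S]
    [BorelSpace S] {Ω : Type*} [mΩ : MeasurableSpace Ω]
    (ν : Measure Ω) [IsProbabilityMeasure ν]
    (μ : Measure S) (p : S → ℝ) (hp : InteractingTempering.IsTargetDensity μ p)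
    (K : ℕ) (hK : 1 ≤ K) (T : ℕ → ℝ) (Tstar : ℝ)
    (hT1 : T 1 = 1) (hT : StrictMonoOn T (Set.Icc 1 K)) (hTK : T K < Tstar)
    (υ : ℝ) (hυ : υ ∈ Set.Ioo (0 : ℝ) 1)
    (P : ℕ → Kernel S S)
    (hMarkov : ∀ i, 1 ≤ i → i < K → IsMarkovKernel (P i))
    (hIrred : ∀ i, 1 ≤ i → i < K →
      Kernel.IsIrreducible (InteractingTempering.powMeasure μ p 1) (P i))
    (hFeller : ∀ i, 1 ≤ i → i < K → InteractingTempering.IsFeller (P i))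
    (hInv : ∀ i, 1 ≤ i → i < K →
      Kernel.Invariant (P i) (InteractingTempering.powMeasure μ p (1 / T i)))
    (hDrift : ∀ i, 1 ≤ i → i < K → ∀ s ∈ Set.Ioo (0 : ℝ) (1 / T i),
      InteractingTempering.HasDrift (P i) (fun x => p x ^ (-s)))
    (X : ℕ → ℕ → Ω → S)
    (hX : InteractingTempering.IsInteractingTempering ν K υ p T P X)
    (Ttilde : ℝ) (hTtilde : Ttilde ∈ Set.Ioo (T K) Tstar)
    (hInt : ∫⁻ x, ENNReal.ofReal (p x ^ (1 / T K - 1 / Ttilde)) ∂μ < ∞)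
    (hSLLN : ∀ f : S → ℝ, Continuous f →
      InteractingTempering.MemWeighted (fun x => p x ^ (-(1 / Ttilde))) f →
      ∀ᵐ ω ∂ν, Tendsto (fun n : ℕ => (n : ℝ)⁻¹ * ∑ k ∈ Finset.Icc 1 n, f (X K k ω)) atTop
        (𝓝 (∫ x, f x * (p x ^ (1 / T K) / ∫ y, p y ^ (1 / T K) ∂μ) ∂μ)))
    (hMoment : ∃ C : ℝ≥0, ∀ n,
      ∫⁻ ω, ENNReal.ofReal (p (X K n ω) ^ (-(1 / Ttilde))) ∂ν ≤ C)
    (hInit : ∀ i, 1 ≤ i → i < K →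
      ∫⁻ ω, ENNReal.ofReal (p (X i 0 ω) ^ (-(1 / Ttilde))) ∂ν < ∞)
    (f : S → ℝ) (hf : Continuous f)
    (hfV : InteractingTempering.MemWeighted (fun x => p x ^ (-(1 / Tstar))) f) :
    Integrable (fun x => f x * p x) μ ∧
      ∀ᵐ ω ∂ν, Tendsto (fun n : ℕ => (n : ℝ)⁻¹ * ∑ k ∈ Finset.Icc 1 n, f (X 1 k ω)) atTop
        (𝓝 (∫ x, f x * p x ∂μ)) := by
  have hpos : ∀ i, 1 ≤ i → i ≤ K → 0 < T i := fun i h1 h2 => by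
    have := hT.monotoneOn ⟨le_rfl, hK⟩ ⟨h1, h2⟩ h1
    linarith
  have hTKpos := hpos K hK le_rfl
  have hTt : 0 < Ttilde := hTKpos.trans hTtilde.1
  have hinvT : ∀ i, 1 ≤ i → i ≤ K → 1 / T K ≤ 1 / T i := fun i h1 h2 =>
    one_div_le_one_div_of_le (hpos i h1 h2) (hT.monotoneOn ⟨h1, h2⟩ ⟨hK, le_rfl⟩ h2)
  have ht0 : 0 < 1 / Ttilde := by positivity
  have htK : 1 / Ttilde < 1 / T K := one_div_lt_one_div_of_lt hTKpos hTtilde.1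
  have hZ : ∀ c, 1 / T K - 1 / Ttilde ≤ c →
      InteractingTempering.powMeasure μ p c Set.univ < ∞ := fun c hc =>
    hp.powMeasure_univ_lt_top hc (by rwa [InteractingTempering.powMeasure_univ])
  -- Induction on the distance `j` from the top level. The moment bound is carried along because the
  -- next level inherits its own from it.
  have hmain : ∀ j i, i + j = K → 1 ≤ i →
      InteractingTempering.HasSLLN ν μ p (1 / T i) (1 / Ttilde) (X i) ∧
      ∃ C : ℝ≥0, ∀ n, ∫⁻ ω, ENNReal.ofReal (p (X i n ω) ^ (-(1 / Ttilde))) ∂ν ≤ C := by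
    intro j
    induction j with
    | zero =>
      rintro i rfl hi
      refine ⟨fun s hs hst g hg hgs => ?_, hMoment⟩
      filter_upwards [hSLLN g hg (hgs.mono_exponent hp hst.le)] with ω hω
      rw [hp.integral_temperedMeasure_eq_integral_mul_div]
      exact InteractingTempering.tendsto_Icc_avg_iff.1 hω
    | succ j ih =>
      intro i hij hi
      obtain ⟨hY, hYm⟩ := ih (i + 1) (by omega) (by omega)
      have hiK : i < K := by omega
      have := hMarkov i hi hiK
      obtain ⟨ℱ, hXa, hYa, hstep⟩ := hX.step i hi hiK
      have hstep' : InteractingTempering.HasTemperStep ν ℱ υ (P i)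
          (fun x => p x ^ (1 / T i - 1 / T (i + 1))) (X i) (X (i + 1)) := by
        rintro n g hg ⟨C, hC⟩
        filter_upwards [hstep n g hg ⟨C, hC⟩] with ω hω
        rw [hω, InteractingTempering.integral_stepLaw hυ hp.pos hp.measurable _ _ hg hC]
      have h1 := hinvT i hi hiK.le
      have h2 := hinvT (i + 1) (by omega) hiK
      have h3 : 1 / T (i + 1) ≤ 1 / T i := one_div_le_one_div_of_le (hpos i hi hiK.le)
        (hT.monotoneOn ⟨hi, hiK.le⟩ ⟨by omega, hiK⟩ (Nat.le_succ i))
      have hmom := InteractingTempering.exists_lintegral_le hυ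
        (hp.measurable.pow_const (1 / T i - 1 / T (i + 1)))
        (fun x => Real.rpow_pos_of_pos (hp.pos x) _) (hX.measurable i hi hiK.le)
        (hX.measurable (i + 1) (by omega) hiK) hstep' (hp.measurable.pow_const (-(1 / Ttilde)))
        (fun x => Real.rpow_nonneg (hp.pos x).le _)
        (hDrift i hi hiK (1 / Ttilde) ⟨ht0, by linarith⟩) hYm (hInit i hi hiK)
      exact ⟨hY.of_hasTemperStep hp hυ h3 (by linarith) ht0 (hZ _ (by linarith))
        (hFeller i hi hiK) (hInv i hi hiK) (hDrift i hi hiK) hXa hstep' hmom, hmom⟩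
  have hs0 : 0 < 1 / Tstar := one_div_pos.2 (hTt.trans hTtilde.2)
  have hst : 1 / Tstar < 1 / Ttilde := one_div_lt_one_div_of_lt hTt hTtilde.2
  have hK1 : 1 / T K ≤ 1 := by simpa [hT1] using hinvT 1 le_rfl hK
  -- The gap `Ttilde < Tstar` is spent here, as the strict inequality `s < t` that `HasSLLN`
  -- demands.
  have hslln := (hmain (K - 1) 1 (by omega) le_rfl).1 (1 / Tstar) hs0.le hst f hf hfV
  have hlim : ∫ x, f x ∂(InteractingTempering.temperedMeasure μ p (1 / T 1)) =
      ∫ x, f x * p x ∂μ := by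
    have hone : InteractingTempering.powMeasure μ p 1 Set.univ = 1 := by
      rw [InteractingTempering.powMeasure_univ]
      simpa using hp.lintegral_eq_one
    rw [hT1, div_one, hp.integral_temperedMeasure, hone]
    simp [mul_comm]
  refine ⟨?_, ?_⟩
  · obtain ⟨C, hC0, hC⟩ := hfV.exists_abs_le hp.pos
    -- This exponent is at least `1 / T K - 1 / Ttilde`, since `T K ≥ 1` and `Tstar > Ttilde`.
    have hi : Integrable (fun x => p x ^ (1 - 1 / Tstar)) μ := by
      refine ⟨(hp.measurable.pow_const _).aestronglyMeasurable, ?_⟩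
      rw [hasFiniteIntegral_iff_ofReal (Eventually.of_forall fun x =>
        Real.rpow_nonneg (hp.pos x).le _), ← InteractingTempering.powMeasure_univ]
      exact hZ _ (by linarith)
    refine (hi.const_mul C).mono' (hf.mul hp.continuous).aestronglyMeasurable
      (Eventually.of_forall fun x => ?_)
    rw [norm_mul, Real.norm_eq_abs, Real.norm_eq_abs, abs_of_pos (hp.pos x),
      show (1 : ℝ) - 1 / Tstar = -(1 / Tstar) + 1 by ring, Real.rpow_add (hp.pos x),
      Real.rpow_one, ← mul_assoc]
    exact mul_le_mul_of_nonneg_right (hC x) (hp.pos x).le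
  · filter_upwards [hslln] with ω hω
    rw [InteractingTempering.tendsto_Icc_avg_iff, ← hlim]
    exact hω
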